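/- Let $I$ be a finite set, let $n_i \geq 2$ for each $i \in I$, and suppose that $n_\delta = 2$ for some $\delta \in I$. An $(n_i)_{i\in I}$-hypertournament is a structure $T$ with one $n_i$-ary relation $R_i$ for each $i \in I$, such that $R_i$ holds only of tuples of distinct elements and, for every $n_i$-element subset $S$ of $T$, the automorphism group of $(S, R_i|_S)$ is the alternating group of $S$. The generic $(n_i)_{i\in I}$-hypertournament $\mathbb{T}$ is the Fraïssé limit of the class of finite $(n_i)_{i\in I}$-hypertournaments: the countable structure, unique up to isomorphism, whose finitely generated substructures are up to isomorphism exactly the finite $(n_i)_{i\in I}$-hypertournaments, and in which every isomorphism between finitely generated substructures extends to an automorphism. For a tuple $\bar v$ of distinct elements put $\rho_i(\bar v) = +1$ if $\bar v \in R_i$ and $\rho_i(\bar v) = -1$ otherwise. A stationary weak independence relation (SWIR) on a countably infinite ultrahomogeneous structure $M$ is a ternary relation $B \perp_A C$ on the finitely generated substructures of $M$ which satisfies the following for all finitely generated $A, B, B', C, C', D$. Here $XY$ denotes the substructure generated by $X \cup Y$, and $B \equiv_A B'$ means that $fB = B'$ for some $f \in \mathrm{Aut}(M)$ fixing $A$ pointwise.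 - Invariance: $B \perp_A C$ implies $gB \perp_{gA} gC$ for $g \in \mathrm{Aut}(M)$. - Existence: there is $B' \equiv_A B$ with $B' \perp_A C$, and there is $C' \equiv_A C$ with $B \perp_A C'$. - Stationarity: if $B \perp_A C$ and $B' \perp_A C$, and $f \in \mathrm{Aut}(M)$ fixes $A$ pointwise with $fB = B'$, then there is $g \in \mathrm{Aut}(M)$ which fixes $AC$ pointwise, agrees with $f$ on $AB$, and satisfies $gB = B'$; if $B \perp_A C$ and $B \perp_A C'$, and $f \in \mathrm{Aut}(M)$ fixes $A$ pointwise with $fC = C'$, then there is $g \in \mathrm{Aut}(M)$ which fixes $AB$ pointwise, agrees with $f$ on $AC$, and satisfies $gC = C'$. - Monotonicity: $BD \perp_A C$ implies $B \perp_A C$ and $D \perp_{AB} C$; and $B \perp_A CD$ implies $B \perp_A C$ and $B \perp_{AC} D$. A SWIR is free if $B \perp_A C$ implies $B \perp_{A'} C$ whenever $A'$ is a finitely generated substructure with $(BC) \cap A \subseteq A' \subseteq A$. Then $\mathbb{T}$ exists, and for each $\delta \in I$ with $n_\delta = 2$ the following relation is a free SWIR on $\mathbb{T}$: $B \perp_A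 C$ if and only if $(B \setminus A) \cap (C \setminus A) = \varnothing$, $\rho_\delta(b, c) = 1$ for all $b \in B \setminus A$ and $c \in C \setminus A$, and $$\rho_i(\bar v) = \prod_{0 \le m < m' < n_i} \rho_\delta(v_m, v_{m'})$$ for every $i \in I$ and every $n_i$-tuple $\bar v = (v_0, \dots, v_{n_i-1})$ of distinct elements of $A \cup B \cup C$ that meets both $B \setminus A$ and $C \setminus A$. Moreover, the automorphism group $\mathrm{Aut}(\mathbb{T})$ is simple. -/

import Mathlib

universe u v w

namespace Hypertournament

open FirstOrder FirstOrder.Language CategoryTheory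

section General

variable {L : FirstOrder.Language.{u, v}} {M : Type w} [L.Structure M]

/-- The automorphism group `Aut(M)` of a first-order structure, under composition. -/
instance autGroup : Group (M ≃[L] M) where
  mul g h := g.comp h
  one := FirstOrder.Language.Equiv.refl L M
  inv g := g.symm
  mul_assoc _ _ _ := rfl
  one_mul _ := rfl
  mul_one _ := rfl
  inv_mul_cancel g := FirstOrder.Language.Equiv.ext fun x => g.toEquiv.symm_apply_apply x

/-- A stationary weak independence relation (SWIR) on the finitely generated substructures of `M`.
`ind B A C` is read "`B` is independent from `C` over `A`". Only the values of `ind` on finitely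
generated substructures matter. The join `A ⊔ B` is the substructure generated by `A ∪ B`, and
`B.map g.toHom` is the image `gB`.

In stationarity, `B ≡_A B'` is witnessed by an automorphism `f` fixing `A` pointwise with
`f B = B'`, and `B ≡_{AC} B'` has to be witnessed by an automorphism `g` fixing `A` and `C`
pointwise which agrees with `f` on the substructure generated by `A ∪ B`. -/
structure IsSWIR (ind : L.Substructure M → L.Substructure M → L.Substructure M → Prop) : Prop where
  inv : ∀ A B C : L.Substructure M, A.FG → B.FG → C.FG → ∀ g : M ≃[L] M,
    ind B A C → ind (B.map g.toHom) (A.map g.toHom) (C.map g.toHom)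
  left_ex : ∀ A B C : L.Substructure M, A.FG → B.FG → C.FG →
    ∃ f : M ≃[L] M, (∀ a ∈ A, f a = a) ∧ ind (B.map f.toHom) A C
  right_ex : ∀ A B C : L.Substructure M, A.FG → B.FG → C.FG →
    ∃ f : M ≃[L] M, (∀ a ∈ A, f a = a) ∧ ind B A (C.map f.toHom)
  left_sta : ∀ A B B' C : L.Substructure M, A.FG → B.FG → B'.FG → C.FG →
    ind B A C → ind B' A C →
    ∀ f : M ≃[L] M, (∀ a ∈ A, f a = a) → B.map f.toHom = B' →
      ∃ g : M ≃[L] M, (∀ x ∈ A ⊔ C, g x = x) ∧ (∀ x ∈ A ⊔ B, g x = f x) ∧ B.map g.toHom = B'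
  right_sta : ∀ A B C C' : L.Substructure M, A.FG → B.FG → C.FG → C'.FG →
    ind B A C → ind B A C' →
    ∀ f : M ≃[L] M, (∀ a ∈ A, f a = a) → C.map f.toHom = C' →
      ∃ g : M ≃[L] M, (∀ x ∈ A ⊔ B, g x = x) ∧ (∀ x ∈ A ⊔ C, g x = f x) ∧ C.map g.toHom = C'
  left_mon : ∀ A B C D : L.Substructure M, A.FG → B.FG → C.FG → D.FG →
    ind (B ⊔ D) A C → ind B A C ∧ ind D (A ⊔ B) C
  right_mon : ∀ A B C D : L.Substructure M, A.FG → B.FG → C.FG → D.FG →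
    ind B A (C ⊔ D) → ind B A C ∧ ind B (A ⊔ C) D

/-- Freeness: the base `A` may be shrunk to any finitely generated `A'` with
`⟨B ∪ C⟩ ∩ A ⊆ A' ⊆ A`. -/
def IsFree (ind : L.Substructure M → L.Substructure M → L.Substructure M → Prop) : Prop :=
  ∀ A A' B C : L.Substructure M, A.FG → A'.FG → B.FG → C.FG →
    ind B A C → (B ⊔ C) ⊓ A ≤ A' → A' ≤ A → ind B A' C

end General

/-- An `n`-ary relation `R` on `A` makes `A` an `n`-hypertournament: `R` holds only of tuples of
distinct elements, and for each `n`-element subset `S` the automorphisms of the substructure on `S`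
are exactly the even permutations of `S`. -/
def IsHypertournament (n : ℕ) {A : Type w} (R : (Fin n → A) → Prop) : Prop :=
  (∀ v, R v → Function.Injective v) ∧
  open Classical in ∀ S : Finset A, S.card = n → ∀ σ : Equiv.Perm S,
    (∀ v : Fin n → S, R (fun k => (σ (v k) : A)) ↔ R (fun k => (v k : A))) ↔
      σ ∈ alternatingGroup S

variable {I : Type v}

/-- The relational language with one relation symbol of arity `n i` for each `i : I`. -/
def lang (n : I → ℕ) : FirstOrder.Language.{0, v} where
  Functions _ := Empty
  Relations k := {i : I // n i = k}

instance lang_isRelational (n : I → ℕ) : (lang n).IsRelational := fun _ =>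
  inferInstanceAs (IsEmpty Empty)

/-- The symbol `R_i`. -/
def sym (n : I → ℕ) (i : I) : (lang n).Relations (n i) := ⟨i, rfl⟩

/-- The class of finite `(n i)_{i ∈ I}`-hypertournaments (with the empty one included). -/
def finiteHypertournaments (n : I → ℕ) : Set (Bundled.{w} (lang n).Structure) :=
  {T | Finite T ∧ ∀ i, IsHypertournament (n i)
    (fun v : Fin (n i) → T => Structure.RelMap (sym n i) v)}

variable {n : I → ℕ} {M : Type w} [(lang n).Structure M]

/-- The sign map `ρ_i`, used only on tuples of distinct elements. -/
noncomputable def rho (i : I) (v : Fin (n i) → M) : ℤ :=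
  open Classical in if Structure.RelMap (sym n i) v then 1 else -1

/-- The sign `ρ_δ(x, y)` for an index `δ` of arity `2`. -/
noncomputable def rhoPair {δ : I} (hδ : n δ = 2) (x y : M) : ℤ :=
  rho δ (fun k => ![x, y] (Fin.cast hδ k))

/-- The independence relation given by sign products: `B \ A` and `C \ A` are disjoint, each
`b ∈ B \ A`, `c ∈ C \ A` satisfy `ρ_δ(b, c) = 1`, and each tuple of distinct elements of
`A ∪ B ∪ C` which meets both `B \ A` and `C \ A` satisfies
`ρ_i(v) = ∏_{m < m'} ρ_δ(v_m, v_{m'})`. -/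
def signIndep {δ : I} (hδ : n δ = 2) (B A C : (lang n).Substructure M) : Prop :=
  Disjoint ((B : Set M) \ A) ((C : Set M) \ A) ∧
  (∀ b ∈ (B : Set M) \ A, ∀ c ∈ (C : Set M) \ A, rhoPair hδ b c = 1) ∧
  ∀ (i : I) (v : Fin (n i) → M), Function.Injective v →
    (∀ k, v k ∈ (A : Set M) ∪ B ∪ C) →
    (∃ k, v k ∈ (B : Set M) \ A) → (∃ k, v k ∈ (C : Set M) \ A) →
    rho i v = ∏ p : Fin (n i) × Fin (n i) with p.1 < p.2, rhoPair hδ (v p.1) (v p.2)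

end Hypertournament

/-!
A relation is a hypertournament relation exactly when it is alternating: it holds only of tuples of
distinct elements, and transposing two entries reverses it (`isHypertournament_iff`). The sign
product `∏_{m < m'} τ(v_m, v_{m'})` of a tournament `τ` is alternating too. Hence hypertournaments
can be glued freely: if parts of a finite set `W` carry compatible hypertournaments, and a
tournament `τ` on `W` extends their relations `R_δ`, then declaring every remaining tuple to follow
the sign product of `τ` gives a hypertournament on `W` (for `R_δ` itself the sign product is `τ`). By
ultrahomogeneity the result is realized in the generic hypertournament, over any prescribed copy of
one of the parts (`exists_realization_of_charts`). Everything rests on this gluing.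

*Existence.* On `ℕ`, let the sign of a tuple be its sign product for `<` times a sign attached to
its set of entries `S`. That sign is read off from a code of `max S`. Each finite code occurs
arbitrarily late, so each one-point extension of a finite part is realized.

*Independence.* Two parts glued over their intersection are independent, which gives the existence
axiom. Stationarity holds because independence determines all relations between `B` and `C` over
`A`, so that partial isomorphisms on `AB` and on `AC` can be united.

*Simplicity.* Call an automorphism `F` rich if it has no finite orbits and if a finite partial
isomorphism `k` can be extended by `x ↦ u`, `y ↦ F u` on a fresh orbit of `F` whenever this is not
excluded by the pairs of points which `k` already sends to pairs `(w, F w)`. Two facts give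
simplicity.

* For each nontrivial `g` some commutator `g⁻¹ h⁻¹ g h` is rich (`exists_isRich`). The automorphism
  `h` is built by finite approximations. Labels in `ℕ × ℤ` on finitely many points record positions
  on orbits of the commutator and keep these orbits from closing up.
* If `F` is rich, then each nontrivial `h` is a product of two conjugates of `F`
  (`IsRich.exists_eq_mul_conj`). One builds `α₁` and `α₂` by back and forth so that
  `x ↦ α₁⁻¹ F α₁ x ↦ h x` is a path through the two conjugates. When one half of such a path is
  forced by the approximation, richness supplies the other half.

So a normal subgroup that contains some `g ≠ 1` contains a rich automorphism, hence everything. The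
points required to be moved by `g` or by `h` exist because a new point `x` can be taken with
`R_δ(x, c)` and not `R_δ(x, g c)`, where `c` is moved (`exists_moved_notMem`).
-/

namespace Hypertournament

open FirstOrder FirstOrder.Language CategoryTheory

/-! ### Alternating relations -/

/-- A relation is alternating if it holds only of tuples of distinct elements, and transposing two
entries of such a tuple reverses its truth value. These are exactly the hypertournament
relations. -/
def IsAlternating {m : ℕ} {A : Type w} (R : (Fin m → A) → Prop) : Prop :=
  (∀ v, R v → Function.Injective v) ∧
    ∀ v, Function.Injective v → ∀ i j, i ≠ j → (R (v ∘ Equiv.swap i j) ↔ ¬ R v)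

theorem IsAlternating.comp_perm {m : ℕ} {A : Type w} {R : (Fin m → A) → Prop}
    (hR : IsAlternating R) (σ : Equiv.Perm (Fin m)) (v : Fin m → A)
    (hv : Function.Injective v) :
    R (v ∘ σ) ↔ (R v ↔ Equiv.Perm.sign σ = 1) := by
  induction σ using Equiv.Perm.swap_induction_on generalizing v with
  | one => simp
  | swap_mul f x y hxy ih =>
    have h := ih (v ∘ Equiv.swap x y) (hv.comp (Equiv.injective _))
    rw [Equiv.Perm.coe_mul, ← Function.comp_assoc, h, hR.2 v hv x y hxy, Equiv.Perm.sign_mul,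
      Equiv.Perm.sign_swap hxy]
    rcases Int.units_eq_one_or (Equiv.Perm.sign f) with h1 | h1 <;> simp [h1]

theorem exists_perm_of_range_eq {m : ℕ} {A : Type w} {v v' : Fin m → A}
    (hv : Function.Injective v) (hv' : Function.Injective v')
    (h : Set.range v' = Set.range v) : ∃ σ : Equiv.Perm (Fin m), v' = v ∘ σ := by
  refine ⟨(Equiv.ofInjective v' hv').trans ((Equiv.setCongr h).trans
    (Equiv.ofInjective v hv).symm), ?_⟩
  funext k
  have := Equiv.apply_ofInjective_symm hv ⟨v' k, h ▸ Set.mem_range_self k⟩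
  exact this.symm

theorem IsAlternating.comp_injective {m : ℕ} {A : Type v} {B : Type w} {R : (Fin m → B) → Prop}
    (hR : IsAlternating R) {f : A → B} (hf : Function.Injective f) :
    IsAlternating (fun v : Fin m → A => R (f ∘ v)) :=
  ⟨fun _ h => (hR.1 _ h).of_comp, fun v hv i j hij => hR.2 (f ∘ v) (hf.comp hv) i j hij⟩

/-- The automorphism condition speaks of one even permutation at a time but of all tuples from `S`. All
tuples of distinct elements of `S` are reorderings of one of them, so it says that even reorderings
preserve the truth value and that transpositions do not. -/
theorem isHypertournament_iff {m : ℕ} {A : Type w} {R : (Fin m → A) → Prop} :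
    IsHypertournament m R ↔ IsAlternating R := by
  classical
  constructor
  · rintro ⟨hinj, hS⟩
    refine ⟨hinj, ?_⟩
    intro v hv i j hij
    set S : Finset A := Finset.univ.image v with hSdef
    have hcard : S.card = m := by
      rw [hSdef, Finset.card_image_of_injective _ hv]; simp
    let e : Fin m ≃ S := (Equiv.ofInjective v hv).trans (Equiv.setCongr (by ext; simp [S]))
    have he : ∀ k, (e k : A) = v k := fun k => rfl
    have key : ∀ σ : Equiv.Perm S, (∀ v : Fin m → S, R (fun k => (σ (v k) : A)) ↔
        R (fun k => (v k : A))) ↔ Equiv.Perm.sign σ = 1 := by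
      intro σ
      have := hS S hcard σ
      rw [Equiv.Perm.mem_alternatingGroup] at this
      convert! this
    -- every injective tuple from `S` is a reordering of `v`
    have even : ∀ π : Equiv.Perm (Fin m), Equiv.Perm.sign π = 1 → (R (v ∘ π) ↔ R v) := by
      intro π hπ
      have := (key (e.permCongr π)).2 (by rw [Equiv.Perm.sign_permCongr, hπ]) e
      simp only [Equiv.permCongr_apply, Equiv.symm_apply_apply, he] at this
      exact this
    by_contra hcon
    have hsame : R (v ∘ Equiv.swap i j) ↔ R v := by tauto
    have odd : ∀ π : Equiv.Perm (Fin m), R (v ∘ π) ↔ R v := by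
      intro π
      rcases Int.units_eq_one_or (Equiv.Perm.sign π) with h1 | h1
      · exact even π h1
      · -- an odd `π` is `(π * swap i j) * swap i j`, and conjugating gives an even permutation
        have h2 := (key (e.permCongr (π * Equiv.swap i j))).2
          (by rw [Equiv.Perm.sign_permCongr, Equiv.Perm.sign_mul, h1, Equiv.Perm.sign_swap hij]
              rfl) (e ∘ Equiv.swap i j)
        simp only [Equiv.permCongr_apply, Equiv.symm_apply_apply, he, Function.comp,
          Equiv.Perm.mul_apply, Equiv.swap_apply_self] at h2
        exact h2.trans hsame
    have h3 : Equiv.Perm.sign (e.permCongr (Equiv.swap i j)) = 1 := by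
      refine (key _).1 fun u => ?_
      by_cases hu : Function.Injective u
      · have hsurj : Function.Surjective (e.symm ∘ u) :=
          Finite.surjective_of_injective (e.symm.injective.comp hu)
        let π : Equiv.Perm (Fin m) :=
          Equiv.ofBijective (e.symm ∘ u) ⟨e.symm.injective.comp hu, hsurj⟩
        have hu' : ∀ k, u k = e (π k) := fun k =>
          (e.apply_symm_apply (u k)).symm
        have e1 : (fun k => ((e.permCongr (Equiv.swap i j)) (u k) : A)) =
            v ∘ (Equiv.swap i j * π : Equiv.Perm (Fin m)) := by
          funext k; simp [hu', Equiv.permCongr_apply, he]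
        have e2 : (fun k => (u k : A)) = v ∘ π := by
          funext k; simp [hu', he]
        rw [e1, e2, odd, odd]
      · constructor
        · intro h
          refine absurd (fun a b hab => ?_) hu
          exact hinj _ h (by simp [hab])
        · intro h
          refine absurd (fun a b hab => ?_) hu
          exact hinj _ h (by simp [hab])
    rw [Equiv.Perm.sign_permCongr, Equiv.Perm.sign_swap hij] at h3
    exact absurd h3 (by decide)
  · intro hR
    refine ⟨hR.1, fun S hS σ => ?_⟩
    rw [Equiv.Perm.mem_alternatingGroup]
    let e : Fin m ≃ S := (Fintype.equivFinOfCardEq (by simp [hS])).symm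
    have hperm : ∀ u : Fin m → S, Function.Injective u →
        (R (fun k => (σ (u k) : A)) ↔ (R (fun k => (u k : A)) ↔ Equiv.Perm.sign σ = 1)) := by
      intro u hu
      have hb : Function.Bijective u :=
        (Fintype.bijective_iff_injective_and_card u).2 ⟨hu, by simp [hS]⟩
      let e' := Equiv.ofBijective u hb
      have h1 : (fun k => (σ (u k) : A)) = (fun k => (u k : A)) ∘ (e'.symm.permCongr σ) := by
        funext k
        have : u (e'.symm (σ (u k))) = σ (u k) := e'.apply_symm_apply _
        simp [Equiv.permCongr_apply, e', this]
      rw [h1, hR.comp_perm _ (fun k => (u k : A)) (Subtype.val_injective.comp hu),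
        Equiv.Perm.sign_permCongr]
    constructor
    · intro h
      have h1 := hperm e e.injective
      rw [h e] at h1
      by_contra h2
      simp [h2] at h1
    · intro h u
      by_cases hu : Function.Injective u
      · rw [hperm u hu]; simp [h]
      · constructor
        · intro h'
          exact absurd (fun a b hab => hR.1 _ h' (by simp [hab])) hu
        · intro h'
          exact absurd (fun a b hab => hR.1 _ h' (by simp [hab])) hu

/-! ### Products over pairs of entries -/

/-- Transposing two entries of a tuple reverses its sign product: reordering multiplies the product
of an antisymmetric `τ` over all pairs by the sign of the permutation. -/
theorem prod_pairs_swap {m : ℕ} {A : Type w} {τ : A → A → ℤ}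
    (hτ : ∀ x y, x ≠ y → τ y x = -τ x y) {v : Fin m → A} (hv : Function.Injective v)
    {i j : Fin m} (hij : i ≠ j) :
    ∏ p : Fin m × Fin m with p.1 < p.2,
        τ ((v ∘ Equiv.swap i j) p.1) ((v ∘ Equiv.swap i j) p.2) =
      -∏ p : Fin m × Fin m with p.1 < p.2, τ (v p.1) (v p.2) := by
  classical
  -- `τ` need not be antisymmetric on the diagonal, which no pair of `v` meets
  have conv : ∀ u : Fin m → A, Function.Injective u →
      ∏ p : Fin m × Fin m with p.1 < p.2, τ (u p.1) (u p.2) =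
        ∏ b, ∏ a ∈ Finset.Iio b, if u a = u b then 0 else τ (u a) (u b) := by
    intro u hu
    rw [Finset.prod_filter, Fintype.prod_prod_type_right]
    refine Finset.prod_congr rfl fun b _ => ?_
    rw [← Finset.prod_filter]
    refine Finset.prod_congr (by ext; simp) fun a ha => ?_
    rw [if_neg]
    intro h
    exact (Finset.mem_Iio.1 ha).ne (hu h)
  rw [conv v hv, conv _ (hv.comp (Equiv.injective _))]
  have := (Equiv.swap i j).prod_Iio_comp_eq_sign_mul_prod
    (f := fun a b => if v a = v b then 0 else τ (v a) (v b)) (by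
      intro a b
      by_cases h : v a = v b
      · simp [h]
      · simp [h, Ne.symm h, hτ _ _ (Ne.symm h)])
  rw [Equiv.Perm.sign_swap hij] at this
  simpa using this

theorem prod_pairs_eq_one_or {m : ℕ} {A : Type w} {τ : A → A → ℤ}
    (hτ : ∀ x y, τ x y = 1 ∨ τ x y = -1) (v : Fin m → A) :
    ∏ p : Fin m × Fin m with p.1 < p.2, τ (v p.1) (v p.2) = 1 ∨
      ∏ p : Fin m × Fin m with p.1 < p.2, τ (v p.1) (v p.2) = -1 := by
  refine Finset.prod_induction _ (fun x : ℤ => x = 1 ∨ x = -1) ?_ (Or.inl rfl) fun p _ => hτ _ _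
  rintro a b (rfl | rfl) (rfl | rfl) <;> simp

theorem prod_pairs_of_eq_two {m : ℕ} (h : m = 2) (f : Fin m → Fin m → ℤ) :
    ∏ p : Fin m × Fin m with p.1 < p.2, f p.1 p.2 = f (Fin.cast h.symm 0) (Fin.cast h.symm 1) := by
  subst h
  rw [Finset.prod_filter, Fintype.prod_prod_type]
  simp [Fin.prod_univ_two]

/-- The sign products over a tournament `τ` form an alternating relation. -/
theorem isAlternating_prod_pairs {m : ℕ} {A : Type w} {τ : A → A → ℤ}
    (hτ : ∀ x y, τ x y = 1 ∨ τ x y = -1) (hτ' : ∀ x y, x ≠ y → τ y x = -τ x y) :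
    IsAlternating fun v : Fin m → A => Function.Injective v ∧
      ∏ p : Fin m × Fin m with p.1 < p.2, τ (v p.1) (v p.2) = 1 := by
  refine ⟨fun v h => h.1, fun v hv i j hij => ?_⟩
  have h1 : Function.Injective (v ∘ Equiv.swap i j) := hv.comp (Equiv.injective _)
  simp only [h1, hv, true_and]
  rw [prod_pairs_swap hτ' hv hij]
  rcases prod_pairs_eq_one_or hτ v with h | h <;> rw [h] <;> decide

variable {I : Type v} {n : I → ℕ}

/-! ### Partial isomorphisms -/

section PartialIso

variable {A B C : Type*} [(lang n).Structure A] [(lang n).Structure B] [(lang n).Structure C]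

/-- A binary relation `s` between two structures is a partial isomorphism if it is the graph of an
injective partial map that preserves and reflects every `R_i`. Encoding partial maps as relations
makes inverses, composites and one-point extensions free of any bookkeeping about domains. -/
def IsPartialIso (n : I → ℕ) {A B : Type*} [(lang n).Structure A] [(lang n).Structure B]
    (s : Set (A × B)) : Prop :=
  (∀ p ∈ s, ∀ q ∈ s, p.1 = q.1 ↔ p.2 = q.2) ∧
    ∀ (i : I) (a : Fin (n i) → A) (b : Fin (n i) → B), (∀ j, (a j, b j) ∈ s) →
      (Structure.RelMap (sym n i) a ↔ Structure.RelMap (sym n i) b)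

theorem IsPartialIso.mono {s t : Set (A × B)} (ht : IsPartialIso n t) (h : s ⊆ t) :
    IsPartialIso n s :=
  ⟨fun p hp q hq => ht.1 p (h hp) q (h hq), fun i a b hab => ht.2 i a b fun j => h (hab j)⟩

theorem IsPartialIso.inv {s : Set (A × B)} (hs : IsPartialIso n s) :
    IsPartialIso n {p : B × A | (p.2, p.1) ∈ s} :=
  ⟨fun _ hp _ hq => (hs.1 _ hp _ hq).symm, fun i a b hab => (hs.2 i b a hab).symm⟩

theorem IsPartialIso.comp {s : Set (A × B)} {t : Set (B × C)} (hs : IsPartialIso n s)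
    (ht : IsPartialIso n t) :
    IsPartialIso n {p : A × C | ∃ b, (p.1, b) ∈ s ∧ (b, p.2) ∈ t} := by
  refine ⟨?_, ?_⟩
  · rintro p ⟨b, hb, hb'⟩ q ⟨c, hc, hc'⟩
    exact (hs.1 _ hb _ hc).trans (ht.1 _ hb' _ hc')
  · intro i a c hac
    choose b hb hb' using hac
    exact (hs.2 i a b hb).trans (ht.2 i b c hb')

theorem IsPartialIso.left_unique {s : Set (A × B)} (hs : IsPartialIso n s) {a a' : A} {b : B}
    (h : (a, b) ∈ s) (h' : (a', b) ∈ s) : a = a' :=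
  (hs.1 _ h _ h').2 rfl

theorem IsPartialIso.right_unique {s : Set (A × B)} (hs : IsPartialIso n s) {a : A} {b b' : B}
    (h : (a, b) ∈ s) (h' : (a, b') ∈ s) : b = b' :=
  (hs.1 _ h _ h').1 rfl

theorem isPartialIso_graph (g : A ≃[lang n] B) : IsPartialIso n {p : A × B | g p.1 = p.2} := by
  refine ⟨?_, ?_⟩
  · rintro p (hp : g p.1 = p.2) q (hq : g q.1 = q.2)
    rw [← hp, ← hq, g.injective.eq_iff]
  · intro i a b hab
    obtain rfl : g ∘ a = b := funext hab
    exact (g.map_rel _ _).symm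

/-- Transport of a partial isomorphism along an automorphism of the target. -/
theorem IsPartialIso.map_right {s : Set (A × B)} (hs : IsPartialIso n s) (g : B ≃[lang n] C) :
    IsPartialIso n {p : A × C | ∃ b, (p.1, b) ∈ s ∧ g b = p.2} :=
  hs.comp (isPartialIso_graph g)

theorem IsPartialIso.map_left {s : Set (A × B)} (hs : IsPartialIso n s) (g : C ≃[lang n] A) :
    IsPartialIso n {p : C × B | (g p.1, p.2) ∈ s} :=
  ((isPartialIso_graph g).comp hs).mono fun p hp => ⟨g p.1, rfl, hp⟩

/-- For alternating relations only tuples of distinct elements have to be inspected. -/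
theorem isPartialIso_of_injective
    (hA : ∀ i, IsAlternating fun v : Fin (n i) → A => Structure.RelMap (sym n i) v)
    (hB : ∀ i, IsAlternating fun v : Fin (n i) → B => Structure.RelMap (sym n i) v)
    {s : Set (A × B)} (h1 : ∀ p ∈ s, ∀ q ∈ s, p.1 = q.1 ↔ p.2 = q.2)
    (h2 : ∀ (i : I) (a : Fin (n i) → A) (b : Fin (n i) → B), Function.Injective a →
      Function.Injective b → (∀ j, (a j, b j) ∈ s) →
      (Structure.RelMap (sym n i) a ↔ Structure.RelMap (sym n i) b)) :
    IsPartialIso n s := by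
  refine ⟨h1, fun i a b hab => ?_⟩
  have hiff : Function.Injective a ↔ Function.Injective b :=
    ⟨fun ha x y hxy => ha ((h1 _ (hab x) _ (hab y)).2 hxy),
      fun hb x y hxy => hb ((h1 _ (hab x) _ (hab y)).1 hxy)⟩
  by_cases ha : Function.Injective a
  · exact h2 i a b ha (hiff.1 ha) hab
  · exact iff_of_false (fun h => ha ((hA i).1 _ h)) fun h => ha (hiff.2 ((hB i).1 _ h))

/-- An injective map that preserves and reflects every `R_i` is an embedding. -/
def mkEmbedding (f : A → B) (hf : Function.Injective f)
    (h : ∀ (i : I) (v : Fin (n i) → A),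
      Structure.RelMap (sym n i) (f ∘ v) ↔ Structure.RelMap (sym n i) v) : A ↪[lang n] B where
  toFun := f
  inj' := hf
  map_fun' := fun c => isEmptyElim (α := Empty) c
  map_rel' := by
    rintro _ ⟨i, rfl⟩ v
    exact h i v

/-- The domain of a partial isomorphism embeds into its codomain. -/
theorem IsPartialIso.exists_embedding {s : Set (A × B)} (hs : IsPartialIso n s)
    (S : (lang n).Substructure A) (hS : ∀ a ∈ S, ∃ b, (a, b) ∈ s) :
    ∃ f : S ↪[lang n] B, ∀ a : S, ((a : A), f a) ∈ s := by
  choose f hf using hS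
  refine ⟨mkEmbedding (fun a : S => f a a.2) ?_ ?_, fun a => hf a a.2⟩
  · intro a a' h
    exact Subtype.ext ((hs.1 _ (hf a a.2) _ (hf a' a'.2)).2 h)
  · intro i v
    exact (hs.2 i (fun j => (v j : A)) _ fun j => hf (v j) (v j).2).symm

end PartialIso

/-! ### Realizing prescribed configurations in the generic hypertournament -/

section Generic

variable {M : Type w} [(lang n).Structure M] [Countable M]

theorem isAlternating_of_isFraisseLimit
    (hM : IsFraisseLimit (finiteHypertournaments.{v, w} n) M) (i : I) :
    IsAlternating fun v : Fin (n i) → M => Structure.RelMap (sym n i) v := by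
  have key : ∀ s : Set M, s.Finite →
      IsAlternating fun v : Fin (n i) → Substructure.closure (lang n) s =>
        Structure.RelMap (sym n i) fun j => (v j : M) := by
    intro s hs
    have h := age.fg_substructure (L := lang n) (M := M) (Substructure.fg_closure hs)
    rw [hM.age] at h
    exact isHypertournament_iff.1 (h.2 i)
  have lift : ∀ v : Fin (n i) → M, ∃ v' : Fin (n i) →
      Substructure.closure (lang n) (Set.range v), ∀ j, (v' j : M) = v j := fun v =>
    ⟨fun j => ⟨v j, Substructure.subset_closure (Set.mem_range_self j)⟩, fun _ => rfl⟩
  constructor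
  · intro v hv
    obtain ⟨v', hv'⟩ := lift v
    have h : (fun j => (v' j : M)) = v := funext hv'
    rw [← h] at hv ⊢
    exact Subtype.val_injective.comp ((key _ (Set.finite_range _)).1 v' hv)
  · intro v hv j k hjk
    obtain ⟨v', hv'⟩ := lift v
    have h : (fun j => (v' j : M)) = v := funext hv'
    have := (key _ (Set.finite_range _)).2 v' (fun a b hab => hv (by
      rw [← hv', ← hv', hab])) j k hjk
    rw [← h]
    exact this

/-- Finite partial isomorphisms of the generic hypertournament extend to automorphisms. -/
theorem exists_equiv_of_isPartialIso
    (hM : IsFraisseLimit (finiteHypertournaments.{v, w} n) M) {s : Set (M × M)} (hf : s.Finite)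
    (hs : IsPartialIso n s) : ∃ g : M ≃[lang n] M, ∀ a b, (a, b) ∈ s → g a = b := by
  have hcl := Substructure.closure_eq_of_isRelational (lang n) (Prod.fst '' s)
  obtain ⟨f, hf'⟩ := hs.exists_embedding (Substructure.closure (lang n) (Prod.fst '' s)) (by
    intro a ha
    rw [← SetLike.mem_coe, hcl] at ha
    obtain ⟨p, hp, rfl⟩ := ha
    exact ⟨p.2, hp⟩)
  obtain ⟨g, hg⟩ := hM.ultrahomogeneous _ (Substructure.fg_closure (hf.image _)) f
  refine ⟨g, fun a b hab => ?_⟩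
  have ha : a ∈ Substructure.closure (lang n) (Prod.fst '' s) :=
    Substructure.subset_closure ⟨_, hab, rfl⟩
  have h1 := hf' ⟨a, ha⟩
  have h2 : f ⟨a, ha⟩ = g a := by rw [hg]; rfl
  rw [← h2]
  exact hs.right_unique h1 hab

theorem rho_eq_one_iff {A : Type*} [(lang n).Structure A] {i : I} {v : Fin (n i) → A} :
    rho i v = 1 ↔ Structure.RelMap (sym n i) v := by
  classical
  unfold rho
  split_ifs with h <;> simp [h]

theorem rho_eq_one_or {A : Type*} [(lang n).Structure A] (i : I) (v : Fin (n i) → A) :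
    rho i v = 1 ∨ rho i v = -1 := by
  classical
  unfold rho
  split_ifs <;> simp

theorem eq_of_eq_one_iff {a b : ℤ} (ha : a = 1 ∨ a = -1) (hb : b = 1 ∨ b = -1)
    (h : a = 1 ↔ b = 1) : a = b := by
  rcases ha with rfl | rfl <;> rcases hb with rfl | rfl <;> simp_all

theorem rho_congr {A B : Type*} [(lang n).Structure A] [(lang n).Structure B] {i : I}
    {v : Fin (n i) → A} {v' : Fin (n i) → B}
    (h : Structure.RelMap (sym n i) v ↔ Structure.RelMap (sym n i) v') : rho i v = rho i v' := by
  classical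
  unfold rho
  simp [h]

theorem rhoPair_eq_one_or {A : Type*} [(lang n).Structure A] {δ : I} (hδ : n δ = 2) (x y : A) :
    rhoPair hδ x y = 1 ∨ rhoPair hδ x y = -1 := rho_eq_one_or _ _

theorem pair_injective {A : Type*} {m : ℕ} (h : m = 2) {x y : A} (hxy : x ≠ y) :
    Function.Injective fun k : Fin m => ![x, y] (Fin.cast h k) := by
  subst h
  intro a b hab
  fin_cases a <;> fin_cases b <;> simp_all

theorem rhoPair_swap {A : Type*} [(lang n).Structure A] {δ : I} (hδ : n δ = 2)
    (hA : IsAlternating fun v : Fin (n δ) → A => Structure.RelMap (sym n δ) v) {x y : A}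
    (hxy : x ≠ y) : rhoPair hδ y x = -rhoPair hδ x y := by
  have h := hA.2 _ (pair_injective hδ hxy) (Fin.cast hδ.symm 0) (Fin.cast hδ.symm 1) (by
    intro h; simpa using congrArg (Fin.cast hδ) h)
  have e : (fun k : Fin (n δ) => ![x, y] (Fin.cast hδ k)) ∘
      Equiv.swap (Fin.cast hδ.symm 0) (Fin.cast hδ.symm 1) =
      fun k : Fin (n δ) => ![y, x] (Fin.cast hδ k) := by
    clear h hA
    generalize n δ = m at hδ
    subst hδ
    funext k
    fin_cases k <;> simp
  rw [e] at h
  beta_reduce at h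
  unfold rhoPair
  rw [← rho_eq_one_iff, ← rho_eq_one_iff] at h
  rcases rho_eq_one_or δ (fun k => ![x, y] (Fin.cast hδ k)) with h1 | h1 <;>
    rcases rho_eq_one_or δ (fun k => ![y, x] (Fin.cast hδ k)) with h2 | h2 <;>
    simp_all

/-- The hypertournament on `W` glued from charts. Each chart `φ c` identifies the part `U c` of `W`
with a part of `M`; tuples covered by a chart inherit its relations, and all others follow the
tournament `τ` through the sign products. -/
@[reducible] def gluedStructure {W : Type*} {κ : Type*} (U : κ → Set W) (φ : κ → W → M)
    (τ : W → W → ℤ) : (lang n).Structure W where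
  funMap := fun f => isEmptyElim (α := Empty) f
  RelMap := fun {_} r v => Function.Injective v ∧
    ((∃ c, (∀ j, v j ∈ U c) ∧ Structure.RelMap (M := M) r (φ c ∘ v)) ∨
      ((∀ c, ∃ j, v j ∉ U c) ∧ ∏ p : Fin _ × Fin _ with p.1 < p.2, τ (v p.1) (v p.2) = 1))

/-- Every finite configuration that is glued from charts in the generic hypertournament, and follows
the sign products of a tournament `τ` on all tuples not covered by a chart, is realized in the
generic hypertournament, extending any one of the charts. -/
theorem exists_realization_of_charts
    (hM : IsFraisseLimit (finiteHypertournaments.{v, w} n) M) {δ : I} (hδ : n δ = 2)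
    {W : Type w} [Finite W] {κ : Type*} (U : κ → Set W) (φ : κ → W → M)
    (hφ : ∀ c, Set.InjOn (φ c) (U c))
    (hcompat : ∀ c c' (i : I) (v : Fin (n i) → W), Function.Injective v →
      (∀ j, v j ∈ U c) → (∀ j, v j ∈ U c') →
      (Structure.RelMap (sym n i) (φ c ∘ v) ↔ Structure.RelMap (sym n i) (φ c' ∘ v)))
    (τ : W → W → ℤ) (hτ : ∀ x y, τ x y = 1 ∨ τ x y = -1) (hτ' : ∀ x y, x ≠ y → τ y x = -τ x y)
    (hτφ : ∀ c, ∀ x ∈ U c, ∀ y ∈ U c, x ≠ y → τ x y = rhoPair hδ (φ c x) (φ c y)) (c₀ : κ) :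
    ∃ e : W → M, Function.Injective e ∧ (∀ x ∈ U c₀, e x = φ c₀ x) ∧
      (∀ c (i : I) (v : Fin (n i) → W), Function.Injective v → (∀ j, v j ∈ U c) →
        (Structure.RelMap (sym n i) (e ∘ v) ↔ Structure.RelMap (sym n i) (φ c ∘ v))) ∧
      (∀ x y, x ≠ y → rhoPair hδ (e x) (e y) = τ x y) ∧
      ∀ (i : I) (v : Fin (n i) → W), Function.Injective v → (∀ c, ∃ j, v j ∉ U c) →
        rho i (e ∘ v) = ∏ p : Fin _ × Fin _ with p.1 < p.2, rhoPair hδ (e (v p.1)) (e (v p.2)) := by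
  have hA := isAlternating_of_isFraisseLimit hM
  let _ : (lang n).Structure W := gluedStructure U φ τ
  have rel_iff : ∀ {i : I} {v : Fin (n i) → W}, Structure.RelMap (sym n i) v ↔
      (Function.Injective v ∧ ((∃ c, (∀ j, v j ∈ U c) ∧ Structure.RelMap (sym n i) (φ c ∘ v)) ∨
      ((∀ c, ∃ j, v j ∉ U c) ∧
        ∏ p : Fin _ × Fin _ with p.1 < p.2, τ (v p.1) (v p.2) = 1))) := Iff.rfl
  have rel_chart : ∀ (c : κ) {i : I} {v : Fin (n i) → W}, Function.Injective v →
      (∀ j, v j ∈ U c) →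
      (Structure.RelMap (sym n i) v ↔ Structure.RelMap (sym n i) (φ c ∘ v)) := by
    intro c i v hv hc
    rw [rel_iff]
    constructor
    · rintro ⟨-, ⟨c', hc', h⟩ | ⟨h, -⟩⟩
      · exact (hcompat c' c i v hv hc' hc).1 h
      · obtain ⟨j, hj⟩ := h c
        exact absurd (hc j) hj
    · exact fun h => ⟨hv, Or.inl ⟨c, hc, h⟩⟩
  have rel_free : ∀ {i : I} {v : Fin (n i) → W}, Function.Injective v → (∀ c, ∃ j, v j ∉ U c) →
      (Structure.RelMap (sym n i) v ↔
        ∏ p : Fin _ × Fin _ with p.1 < p.2, τ (v p.1) (v p.2) = 1) := by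
    intro i v hv hc
    rw [rel_iff]
    constructor
    · rintro ⟨-, ⟨c', hc', h⟩ | ⟨-, h⟩⟩
      · obtain ⟨j, hj⟩ := hc c'
        exact absurd (hc' j) hj
      · exact h
    · exact fun h => ⟨hv, Or.inr ⟨hc, h⟩⟩
  have hW : ∀ i, IsAlternating fun v : Fin (n i) → W => Structure.RelMap (sym n i) v := by
    intro i
    refine ⟨fun v hv => hv.1, fun v hv j k hjk => ?_⟩
    have hv' : Function.Injective (v ∘ Equiv.swap j k) := hv.comp (Equiv.injective _)
    by_cases hc : ∃ c, ∀ j, v j ∈ U c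
    · obtain ⟨c, hc⟩ := hc
      beta_reduce
      rw [rel_chart c hv hc, rel_chart c hv' fun _ => hc _]
      exact (hA i).2 (φ c ∘ v) (fun x y hxy => hv (hφ c (hc x) (hc y) hxy)) j k hjk
    · push Not at hc
      have hc' : ∀ c, ∃ l, (v ∘ Equiv.swap j k) l ∉ U c := by
        intro c
        obtain ⟨l, hl⟩ := hc c
        exact ⟨Equiv.swap j k l, by simpa using hl⟩
      beta_reduce
      rw [rel_free hv hc, rel_free hv' hc']
      simp only [prod_pairs_swap hτ' hv hjk]
      rcases prod_pairs_eq_one_or hτ v with h | h <;> rw [h] <;> decide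
  have hτW : ∀ x y : W, x ≠ y → rhoPair hδ x y = τ x y := by
    intro x y hxy
    have hinj := pair_injective hδ hxy
    have hmem : ∀ S : Set W, (∀ k, ![x, y] (Fin.cast hδ k) ∈ S) ↔ x ∈ S ∧ y ∈ S := by
      intro S
      constructor
      · intro h
        exact ⟨by simpa using h (Fin.cast hδ.symm 0), by simpa using h (Fin.cast hδ.symm 1)⟩
      · rintro ⟨hx, hy⟩ k
        generalize Fin.cast hδ k = l
        fin_cases l <;> simpa
    have hiff : rhoPair hδ x y = 1 ↔ τ x y = 1 := by
      unfold rhoPair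
      rw [rho_eq_one_iff]
      by_cases hc : ∃ c, x ∈ U c ∧ y ∈ U c
      · obtain ⟨c, hx, hy⟩ := hc
        rw [rel_chart c hinj ((hmem _).2 ⟨hx, hy⟩), hτφ c x hx y hy hxy, rhoPair, rho_eq_one_iff]
        have : (φ c ∘ fun k => ![x, y] (Fin.cast hδ k)) =
            fun k => ![φ c x, φ c y] (Fin.cast hδ k) := by
          funext k
          simp only [Function.comp]
          generalize Fin.cast hδ k = l
          fin_cases l <;> rfl
        rw [this]
      · rw [rel_free hinj (fun c => by
          by_contra! h
          exact hc ⟨c, (hmem _).1 h⟩)]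
        rw [prod_pairs_of_eq_two hδ fun a b =>
          τ (![x, y] (Fin.cast hδ a)) (![x, y] (Fin.cast hδ b))]
        simp
    exact eq_of_eq_one_iff (rhoPair_eq_one_or hδ x y) (hτ x y) hiff
  have hK : (Bundled.of W : Bundled.{w} (lang n).Structure) ∈ (lang n).age M := by
    rw [hM.age]
    exact ⟨‹_›, fun i => isHypertournament_iff.2 (hW i)⟩
  obtain ⟨e'⟩ : Nonempty (W ↪[lang n] M) := hK.2
  -- move the copy of `W` in `M` so that the chart `c₀` gets its prescribed position
  have hpi : IsPartialIso n {p : M × M | ∃ x ∈ U c₀, e' x = p.1 ∧ φ c₀ x = p.2} := by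
    refine isPartialIso_of_injective hA hA ?_ ?_
    · rintro p ⟨x, hx, h1, h2⟩ q ⟨y, hy, h3, h4⟩
      rw [← h1, ← h2, ← h3, ← h4, e'.injective.eq_iff, (hφ c₀).eq_iff hx hy]
    · intro i a b ha hb hab
      choose x hx h1 h2 using hab
      obtain rfl : e' ∘ x = a := funext h1
      obtain rfl : φ c₀ ∘ x = b := funext h2
      rw [e'.map_rel]
      exact rel_chart c₀ ha.of_comp hx
  obtain ⟨g, hg⟩ := exists_equiv_of_isPartialIso hM (by
    refine ((Set.toFinite (U c₀)).image fun x => (e' x, φ c₀ x)).subset ?_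
    rintro p ⟨x, hx, h1, h2⟩
    exact ⟨x, hx, Prod.ext h1 h2⟩) hpi
  have hrel : ∀ {i : I} (v : Fin (n i) → W),
      Structure.RelMap (sym n i) ((fun x => g (e' x)) ∘ v) ↔ Structure.RelMap (sym n i) v :=
    fun v => (g.map_rel (sym n _) (e' ∘ v)).trans (e'.map_rel (sym n _) v)
  have hpair : ∀ x y : W, rhoPair hδ (g (e' x)) (g (e' y)) = rhoPair hδ x y := by
    intro x y
    unfold rhoPair
    rw [← rho_congr (hrel _)]
    congr 1
    funext k
    simp only [Function.comp]
    generalize Fin.cast hδ k = l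
    fin_cases l <;> rfl
  refine ⟨fun x => g (e' x), fun x y h => e'.injective (g.injective h),
    fun x hx => hg _ _ ⟨x, hx, rfl, rfl⟩, fun c i v hv hc => (hrel v).trans (rel_chart c hv hc),
    fun x y hxy => (hpair x y).trans (hτW x y hxy), fun i v hv hc => ?_⟩
  have h1 : ∏ p : Fin (n i) × Fin (n i) with p.1 < p.2,
      rhoPair hδ (g (e' (v p.1))) (g (e' (v p.2))) =
      ∏ p : Fin (n i) × Fin (n i) with p.1 < p.2, τ (v p.1) (v p.2) := by
    refine Finset.prod_congr rfl fun p hp => ?_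
    rw [hpair, hτW]
    exact fun h => (Finset.mem_filter.1 hp).2.ne (hv h)
  rw [h1, rho_congr (hrel v)]
  exact eq_of_eq_one_iff (rho_eq_one_or i v) (prod_pairs_eq_one_or hτ v)
    (rho_eq_one_iff.trans (rel_free hv hc))

end Generic

/-! ### The sign-product relation is a free stationary weak independence relation -/

section SignIndep

variable {M : Type w} [(lang n).Structure M]

theorem mem_sup_iff {A B : (lang n).Substructure M} {x : M} : x ∈ A ⊔ B ↔ x ∈ A ∨ x ∈ B := by
  rw [← Substructure.closure_eq A, ← Substructure.closure_eq B, ← Substructure.closure_union,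
    Substructure.mem_closure_iff_of_isRelational, Substructure.closure_eq,
    Substructure.closure_eq]
  rfl

theorem rho_map (g : M ≃[lang n] M) {i : I} (v : Fin (n i) → M) : rho i (g ∘ v) = rho i v :=
  rho_congr (g.map_rel _ _)

theorem rhoPair_comp {A B : Type*} [(lang n).Structure A] [(lang n).Structure B] {δ : I}
    (hδ : n δ = 2) {f : A → B} {x y : A}
    (h : ∀ v : Fin (n δ) → A, (∀ k, v k = x ∨ v k = y) → rho δ (f ∘ v) = rho δ v) :
    rhoPair hδ (f x) (f y) = rhoPair hδ x y := by
  unfold rhoPair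
  rw [← h]
  · congr 1
    funext k
    simp only [Function.comp]
    generalize Fin.cast hδ k = l
    fin_cases l <;> rfl
  · intro k
    generalize Fin.cast hδ k = l
    fin_cases l <;> simp

theorem rhoPair_map {δ : I} (hδ : n δ = 2) (g : M ≃[lang n] M) (x y : M) :
    rhoPair hδ (g x) (g y) = rhoPair hδ x y :=
  rhoPair_comp hδ fun v _ => rho_map g v

theorem mem_map_diff_iff {A B : (lang n).Substructure M} (g : M ≃[lang n] M) {x : M} :
    x ∈ (B.map g.toHom : Set M) \ A.map g.toHom ↔ ∃ b ∈ (B : Set M) \ A, g b = x := by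
  constructor
  · rintro ⟨⟨b, hb, rfl⟩, h⟩
    exact ⟨b, ⟨hb, fun ha => h ⟨b, ha, rfl⟩⟩, rfl⟩
  · rintro ⟨b, ⟨hb, hb'⟩, rfl⟩
    refine ⟨⟨b, hb, rfl⟩, ?_⟩
    rintro ⟨a, ha, h⟩
    exact hb' (g.injective h ▸ ha)

theorem map_eq_self {A : (lang n).Substructure M} {g : M ≃[lang n] M} (h : ∀ a ∈ A, g a = a) :
    A.map g.toHom = A := by
  ext x
  constructor
  · rintro ⟨a, ha, rfl⟩
    exact (h a ha).symm ▸ ha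
  · exact fun hx => ⟨x, hx, h x hx⟩

variable {δ : I} (hδ : n δ = 2)

theorem signIndep_map {A B C : (lang n).Substructure M} (g : M ≃[lang n] M)
    (h : signIndep hδ B A C) :
    signIndep hδ (B.map g.toHom) (A.map g.toHom) (C.map g.toHom) := by
  obtain ⟨h1, h2, h3⟩ := h
  refine ⟨?_, ?_, ?_⟩
  · rw [Set.disjoint_left]
    intro x hx hx'
    obtain ⟨b, hb, rfl⟩ := (mem_map_diff_iff g).1 hx
    obtain ⟨c, hc, h⟩ := (mem_map_diff_iff g).1 hx'
    exact Set.disjoint_left.1 h1 hb (g.injective h ▸ hc)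
  · intro x hx y hy
    obtain ⟨b, hb, rfl⟩ := (mem_map_diff_iff g).1 hx
    obtain ⟨c, hc, rfl⟩ := (mem_map_diff_iff g).1 hy
    rw [rhoPair_map]
    exact h2 b hb c hc
  · rintro i v hv hmem ⟨k, hk⟩ ⟨l, hl⟩
    have hmem' : ∀ k, ∃ x ∈ (A : Set M) ∪ B ∪ C, g x = v k := by
      intro k
      rcases hmem k with (⟨x, hx, h⟩ | ⟨x, hx, h⟩) | ⟨x, hx, h⟩
      · exact ⟨x, Or.inl (Or.inl hx), h⟩
      · exact ⟨x, Or.inl (Or.inr hx), h⟩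
      · exact ⟨x, Or.inr hx, h⟩
    choose u hu huv using hmem'
    obtain rfl : g ∘ u = v := funext huv
    obtain ⟨b, hb, hbk⟩ := (mem_map_diff_iff g).1 hk
    obtain ⟨c, hc, hcl⟩ := (mem_map_diff_iff g).1 hl
    have := h3 i u hv.of_comp hu ⟨k, g.injective hbk ▸ hb⟩ ⟨l, g.injective hcl ▸ hc⟩
    rw [rho_map, this]
    simp only [Function.comp, rhoPair_map]

theorem signIndep_mono {A A' B B' C C' : (lang n).Substructure M} (h : signIndep hδ B A C)
    (hB : (B' : Set M) \ A' ⊆ B \ A) (hC : (C' : Set M) \ A' ⊆ C \ A)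
    (hU : (A' : Set M) ∪ B' ∪ C' ⊆ A ∪ B ∪ C) : signIndep hδ B' A' C' := by
  obtain ⟨h1, h2, h3⟩ := h
  refine ⟨h1.mono hB hC, fun b hb c hc => h2 b (hB hb) c (hC hc), ?_⟩
  rintro i v hv hmem ⟨k, hk⟩ ⟨l, hl⟩
  exact h3 i v hv (fun j => hU (hmem j)) ⟨k, hB hk⟩ ⟨l, hC hl⟩

/-- The relations on `A ∪ B ∪ C` are determined by those on `A ∪ B` and on `A ∪ C` when `B` and `C`
are independent over `A`; hence isomorphisms of the two sides that fix `A` can be combined. -/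
theorem isPartialIso_of_signIndep
    (hM : ∀ i, IsAlternating fun v : Fin (n i) → M => Structure.RelMap (sym n i) v)
    {A B C B' C' : (lang n).Substructure M} (h : signIndep hδ B A C) (h' : signIndep hδ B' A C')
    {f g : M ≃[lang n] M} (hf : ∀ a ∈ A, f a = a) (hg : ∀ a ∈ A, g a = a)
    (hfB : B.map f.toHom = B') (hgC : C.map g.toHom = C') :
    IsPartialIso n {p : M × M | (p.1 ∈ A ⊔ B ∧ f p.1 = p.2) ∨ (p.1 ∈ A ⊔ C ∧ g p.1 = p.2)} := by
  subst hfB hgC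
  have inter : ∀ x, x ∈ A ⊔ B → x ∈ A ⊔ C → x ∈ A := by
    intro x hx hx'
    rw [mem_sup_iff] at hx hx'
    by_contra hA
    exact Set.disjoint_left.1 h.1 ⟨hx.resolve_left hA, hA⟩ ⟨hx'.resolve_left hA, hA⟩
  have fA : ∀ x, f x ∈ A → x ∈ A := fun x hx => f.injective (hf _ hx) ▸ hx
  have gA : ∀ x, g x ∈ A → x ∈ A := fun x hx => g.injective (hg _ hx) ▸ hx
  have cross : ∀ x y, x ∈ A ⊔ B → y ∈ A ⊔ C → (x = y ↔ f x = g y) := by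
    intro x y hx hy
    constructor
    · rintro rfl
      rw [hf x (inter x hx hy), hg x (inter x hx hy)]
    · intro hxy
      have hxA : x ∈ A := by
        rcases mem_sup_iff.1 hx with hxA | hxB
        · exact hxA
        rcases mem_sup_iff.1 hy with hyA | hyC
        · refine fA x ?_
          rw [hxy, hg y hyA]
          exact hyA
        · by_contra hxA
          have hx1 : f x ∈ (B.map f.toHom : Set M) \ A :=
            ⟨⟨x, hxB, rfl⟩, fun h => hxA (fA x h)⟩
          exact Set.disjoint_left.1 h'.1 hx1 ⟨⟨y, hyC, hxy.symm⟩, hx1.2⟩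
      have hyA : y ∈ A := gA y (by rw [← hxy, hf x hxA]; exact hxA)
      rwa [hf x hxA, hg y hyA] at hxy
  refine isPartialIso_of_injective hM hM ?_ ?_
  · rintro ⟨p, p'⟩ (⟨hp, h1⟩ | ⟨hp, h1⟩) ⟨q, q'⟩ (⟨hq, h2⟩ | ⟨hq, h2⟩) <;>
      simp only at hp h1 hq h2 ⊢ <;> rw [← h1, ← h2]
    · exact f.injective.eq_iff.symm
    · exact cross p q hp hq
    · rw [eq_comm, cross q p hq hp, eq_comm]
    · exact g.injective.eq_iff.symm
  · intro i a b ha hb hab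
    have hab1 : ∀ j, a j ∈ A ⊔ B → f (a j) = b j := by
      intro j hj
      rcases hab j with ⟨-, h1⟩ | ⟨h1, h2⟩
      · exact h1
      · exact ((cross (a j) (a j) hj h1).1 rfl).trans h2
    have hab2 : ∀ j, a j ∈ A ⊔ C → g (a j) = b j := by
      intro j hj
      rcases hab j with ⟨h1, h2⟩ | ⟨-, h1⟩
      · exact ((cross (a j) (a j) h1 hj).1 rfl).symm.trans h2
      · exact h1
    have hor : ∀ j, a j ∈ A ⊔ B ∨ a j ∈ A ⊔ C := fun j => (hab j).imp And.left And.left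
    by_cases hB : ∀ j, a j ∈ A ⊔ B
    · obtain rfl : f ∘ a = b := funext fun j => hab1 j (hB j)
      exact (f.map_rel _ _).symm
    by_cases hC : ∀ j, a j ∈ A ⊔ C
    · obtain rfl : g ∘ a = b := funext fun j => hab2 j (hC j)
      exact (g.map_rel _ _).symm
    push Not at hB hC
    obtain ⟨l, hl⟩ := hB
    obtain ⟨k, hk⟩ := hC
    have memB : ∀ j, a j ∉ A ⊔ C → a j ∈ (B : Set M) \ A := fun j hj =>
      ⟨(mem_sup_iff.1 ((hor j).resolve_right hj)).resolve_left
        fun h => hj (mem_sup_iff.2 (Or.inl h)), fun h => hj (mem_sup_iff.2 (Or.inl h))⟩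
    have memC : ∀ j, a j ∉ A ⊔ B → a j ∈ (C : Set M) \ A := fun j hj =>
      ⟨(mem_sup_iff.1 ((hor j).resolve_left hj)).resolve_left
        fun h => hj (mem_sup_iff.2 (Or.inl h)), fun h => hj (mem_sup_iff.2 (Or.inl h))⟩
    have memB' : ∀ j, a j ∉ A ⊔ C → b j ∈ (B.map f.toHom : Set M) \ A := by
      intro j hj
      rw [← hab1 j ((hor j).resolve_right hj)]
      exact ⟨⟨_, (memB j hj).1, rfl⟩, fun h => (memB j hj).2 (fA _ h)⟩
    have memC' : ∀ j, a j ∉ A ⊔ B → b j ∈ (C.map g.toHom : Set M) \ A := by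
      intro j hj
      rw [← hab2 j ((hor j).resolve_left hj)]
      exact ⟨⟨_, (memC j hj).1, rfl⟩, fun h => (memC j hj).2 (gA _ h)⟩
    have e1 := h.2.2 i a ha (fun j => by
      rcases hor j with h1 | h1 <;> rcases mem_sup_iff.1 h1 with h2 | h2
      · exact Or.inl (Or.inl h2)
      · exact Or.inl (Or.inr h2)
      · exact Or.inl (Or.inl h2)
      · exact Or.inr h2) ⟨k, memB k hk⟩ ⟨l, memC l hl⟩
    have e2 := h'.2.2 i b hb (fun j => by
      rcases hor j with h1 | h1 <;> rcases mem_sup_iff.1 h1 with h2 | h2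
      · rw [← hab1 j h1, hf _ h2]
        exact Or.inl (Or.inl h2)
      · rw [← hab1 j h1]
        exact Or.inl (Or.inr ⟨_, h2, rfl⟩)
      · rw [← hab2 j h1, hg _ h2]
        exact Or.inl (Or.inl h2)
      · rw [← hab2 j h1]
        exact Or.inr ⟨_, h2, rfl⟩) ⟨k, memB' k hk⟩ ⟨l, memC' l hl⟩
    rw [← rho_eq_one_iff, ← rho_eq_one_iff, e1, e2]
    have e3 : ∀ x y, x ≠ y → rhoPair hδ (a x) (a y) = rhoPair hδ (b x) (b y) := by
      intro x y hxy
      by_cases hx1 : a x ∈ A ⊔ B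
      · by_cases hy1 : a y ∈ A ⊔ B
        · rw [← hab1 x hx1, ← hab1 y hy1, rhoPair_map]
        · by_cases hx2 : a x ∈ A ⊔ C
          · have hy2 := (hor y).resolve_left hy1
            rw [← hab2 x hx2, ← hab2 y hy2, rhoPair_map]
          · rw [h.2.1 _ (memB x hx2) _ (memC y hy1), h'.2.1 _ (memB' x hx2) _ (memC' y hy1)]
      · have hx2 := (hor x).resolve_left hx1
        by_cases hy2 : a y ∈ A ⊔ C
        · rw [← hab2 x hx2, ← hab2 y hy2, rhoPair_map]
        · rw [rhoPair_swap hδ (hM δ) (ha.ne hxy.symm), rhoPair_swap hδ (hM δ) (hb.ne hxy.symm),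
            h.2.1 _ (memB y hy2) _ (memC x hx1), h'.2.1 _ (memB' y hy2) _ (memC' x hx1)]
    rw [Finset.prod_congr rfl fun p hp => e3 p.1 p.2 (Finset.mem_filter.1 hp).2.ne]

theorem isFree_signIndep : IsFree (signIndep (M := M) hδ) := by
  intro A A' B C _ _ _ _ h h1 h2
  have h1' : ∀ x, (x ∈ B ∨ x ∈ C) → x ∈ A → x ∈ A' := fun x hx hA =>
    h1 ⟨mem_sup_iff.2 hx, hA⟩
  have h2' : ∀ x, x ∈ A' → x ∈ A := fun x hx => h2 hx
  refine signIndep_mono hδ h ?_ ?_ ?_ <;> intro x hx <;> have := h1' x <;> have := h2' x <;>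
    simp only [Set.mem_sdiff, Set.mem_union, SetLike.mem_coe] at hx ⊢ <;> tauto

variable [Countable M]

/-- Independence over a given base can be achieved by moving the left side: glue `A ∪ B` and
`A ∪ C` along `A`, and let `τ` prescribe the value `1` from `B \ A` to `C \ A`. -/
theorem exists_signIndep_left (hM : IsFraisseLimit (finiteHypertournaments.{v, w} n) M)
    (A B C : (lang n).Substructure M) (hA : A.FG) (hB : B.FG) (hC : C.FG) :
    ∃ f : M ≃[lang n] M, (∀ a ∈ A, f a = a) ∧ signIndep hδ (B.map f.toHom) A C := by
  classical
  have hAlt := isAlternating_of_isFraisseLimit hM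
  have : Finite A := hA.finite
  have : Finite B := hB.finite
  have : Finite (A ⊔ C : (lang n).Substructure M) := (hA.sup hC).finite
  have : Finite {b : B // (b : M) ∉ A} := inferInstance
  -- the charts are `A ∪ C` (`true`) and `A ∪ B` (`false`)
  let W : Type w := (A ⊔ C : (lang n).Substructure M) ⊕ {b : B // (b : M) ∉ A}
  let φ : W → M := Sum.elim (fun x => (x : M)) (fun b => (b.1 : M))
  let U : Bool → Set W := fun c => {x | x.isLeft = true ∧ c = true ∨
    c = false ∧ (x.isLeft = true → φ x ∈ A)}
  let τ : W → W → ℤ := fun x y => match x, y with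
    | .inl x, .inl y => rhoPair hδ (x : M) y
    | .inr x, .inr y => rhoPair hδ (x.1 : M) y.1
    | .inl x, .inr y => if (x : M) ∈ A then rhoPair hδ (x : M) y.1 else -1
    | .inr x, .inl y => if (y : M) ∈ A then rhoPair hδ (x.1 : M) y else 1
  obtain ⟨e, he, he1, he2, he3, he4⟩ := exists_realization_of_charts hM hδ U (fun _ => φ) (by
      rintro (_ | _) (x | x) hx (y | y) hy h
      · exact congrArg _ (Subtype.ext h)
      · exact absurd (show (y.1 : M) ∈ A from
          (show (x : M) = y.1 from h) ▸ (hx.resolve_left (by simp)).2 rfl) y.2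
      · exact absurd (show (x.1 : M) ∈ A from
          (show (x.1 : M) = y from h) ▸ (hy.resolve_left (by simp)).2 rfl) x.2
      · exact congrArg _ (Subtype.ext (Subtype.ext h))
      · exact congrArg _ (Subtype.ext h)
      · exact absurd hy (by simp [U])
      · exact absurd hx (by simp [U])
      · exact absurd hx (by simp [U])) (fun _ _ _ _ _ _ _ => Iff.rfl) τ (by
      rintro (x | x) (y | y)
      · exact rhoPair_eq_one_or hδ _ _
      · simp only [τ]
        split_ifs
        · exact rhoPair_eq_one_or hδ _ _
        · simp
      · simp only [τ]
        split_ifs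
        · exact rhoPair_eq_one_or hδ _ _
        · simp
      · exact rhoPair_eq_one_or hδ _ _) (by
      rintro (x | x) (y | y) hxy
      · exact rhoPair_swap hδ (hAlt δ) fun h => hxy (congrArg _ (Subtype.ext h))
      · simp only [τ]
        split_ifs with h
        · exact rhoPair_swap hδ (hAlt δ) fun h' => y.2 (h' ▸ h)
        · simp
      · simp only [τ]
        split_ifs with h
        · exact rhoPair_swap hδ (hAlt δ) fun h' => x.2 (h' ▸ h)
        · simp
      · exact rhoPair_swap hδ (hAlt δ) fun h => hxy (congrArg _ (Subtype.ext (Subtype.ext h))))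
    (by
      rintro (_ | _) (x | x) hx (y | y) hy hxy
      · rfl
      · exact if_pos ((hx.resolve_left (by simp)).2 rfl)
      · exact if_pos ((hy.resolve_left (by simp)).2 rfl)
      · rfl
      · rfl
      · exact absurd hy (by simp [U])
      · exact absurd hx (by simp [U])
      · rfl) true
  have he1' : ∀ x (hx : x ∈ A ⊔ C), e (.inl ⟨x, hx⟩) = x := fun x hx =>
    he1 (.inl ⟨x, hx⟩) (by simp [U])
  have hinr : ∀ b, Sum.inr b ∈ U false := fun b =>
    Or.inr ⟨rfl, by simp⟩
  have hinl : ∀ a (ha : a ∈ A), Sum.inl ⟨a, mem_sup_iff.2 (Or.inl ha)⟩ ∈ U false := fun a ha =>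
    Or.inr ⟨rfl, fun _ => ha⟩
  have hpi : IsPartialIso n {p : M × M | ∃ x ∈ U false, φ x = p.1 ∧ e x = p.2} := by
    refine isPartialIso_of_injective hAlt hAlt ?_ ?_
    · rintro ⟨p, p'⟩ ⟨x, hx, rfl, rfl⟩ ⟨q, q'⟩ ⟨y, hy, rfl, rfl⟩
      constructor
      · rintro h
        rcases x with x | x <;> rcases y with y | y
        · exact congrArg e (congrArg _ (Subtype.ext h))
        · exact absurd (show (y.1 : M) ∈ A from
          (show (x : M) = y.1 from h) ▸ (hx.resolve_left (by simp)).2 rfl) y.2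
        · exact absurd (show (x.1 : M) ∈ A from
          (show (x.1 : M) = y from h) ▸ (hy.resolve_left (by simp)).2 rfl) x.2
        · exact congrArg e (congrArg _ (Subtype.ext (Subtype.ext h)))
      · intro h
        exact congrArg φ (he h)
    · intro i a b ha hb hab
      choose x hx h1 h2 using hab
      obtain rfl : φ ∘ x = a := funext h1
      obtain rfl : e ∘ x = b := funext h2
      exact (he2 false i x ha.of_comp hx).symm
  obtain ⟨f, hf⟩ := exists_equiv_of_isPartialIso hM (by
    refine ((Set.toFinite (U false)).image fun x => (φ x, e x)).subset ?_
    rintro p ⟨x, hx, h1, h2⟩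
    exact ⟨x, hx, Prod.ext h1 h2⟩) hpi
  have hfA : ∀ a ∈ A, f a = a := fun a ha =>
    hf _ _ ⟨.inl ⟨a, mem_sup_iff.2 (Or.inl ha)⟩, hinl a ha, rfl, he1' _ _⟩
  have hfB : ∀ b : {b : B // (b : M) ∉ A}, f b.1 = e (.inr b) := fun b =>
    hf _ _ ⟨.inr b, hinr b, rfl, rfl⟩
  have hB' : ∀ x ∈ (B.map f.toHom : Set M) \ A, ∃ b, e (.inr b) = x := by
    rintro x ⟨⟨b, hb, rfl⟩, hx⟩
    have hbA : b ∉ A := fun h => hx (by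
      rw [show f.toHom b = b from hfA b h]
      exact h)
    exact ⟨⟨⟨b, hb⟩, hbA⟩, (hfB _).symm⟩
  have hC' : ∀ x ∈ (C : Set M) \ A, ∃ c : (A ⊔ C : (lang n).Substructure M),
      (c : M) ∉ A ∧ e (.inl c) = x := fun x hx =>
    ⟨⟨x, mem_sup_iff.2 (Or.inr hx.1)⟩, hx.2, he1' _ _⟩
  refine ⟨f, hfA, ?_, ?_, ?_⟩
  · rw [Set.disjoint_left]
    intro x hx hx'
    obtain ⟨b, rfl⟩ := hB' x hx
    obtain ⟨c, -, h⟩ := hC' _ hx'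
    exact absurd (he h) (by simp)
  · intro x hx y hy
    obtain ⟨b, rfl⟩ := hB' x hx
    obtain ⟨c, hc, rfl⟩ := hC' y hy
    rw [he3 _ _ (by simp)]
    exact if_neg hc
  · rintro i v hv hmem ⟨k, hk⟩ ⟨l, hl⟩
    have hmem' : ∀ j, ∃ x : W, e x = v j := by
      intro j
      by_cases hj : v j ∈ A
      · exact ⟨.inl ⟨v j, mem_sup_iff.2 (Or.inl hj)⟩, he1' _ _⟩
      rcases hmem j with (h | h) | h
      · exact absurd h hj
      · obtain ⟨b, hb⟩ := hB' (v j) ⟨h, hj⟩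
        exact ⟨_, hb⟩
      · obtain ⟨c, -, hc⟩ := hC' (v j) ⟨h, hj⟩
        exact ⟨_, hc⟩
    choose x hx using hmem'
    obtain rfl : e ∘ x = v := funext hx
    refine he4 i x hv.of_comp ?_
    obtain ⟨b, hb⟩ := hB' _ hk
    obtain ⟨c, hc, hc'⟩ := hC' _ hl
    have hb := he hb
    have hc' := he hc'
    rintro (_ | _)
    · refine ⟨l, ?_⟩
      rw [← hc']
      exact fun h => hc ((h.resolve_left (by simp)).2 rfl)
    · refine ⟨k, ?_⟩
      rw [← hb]
      simp [U]

theorem isSWIR_signIndep (hM : IsFraisseLimit (finiteHypertournaments.{v, w} n) M) :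
    IsSWIR (signIndep (M := M) hδ) := by
  have hAlt := isAlternating_of_isFraisseLimit hM
  have fin : ∀ {A B C : (lang n).Substructure M} (f g : M ≃[lang n] M), A.FG → B.FG → C.FG →
      {p : M × M | (p.1 ∈ A ⊔ B ∧ f p.1 = p.2) ∨ (p.1 ∈ A ⊔ C ∧ g p.1 = p.2)}.Finite := by
    intro A B C f g hA hB hC
    have h1 : (A ⊔ B : (lang n).Substructure M).carrier.Finite := (hA.sup hB).finite
    have h2 : (A ⊔ C : (lang n).Substructure M).carrier.Finite := (hA.sup hC).finite
    refine ((h1.image fun x => (x, f x)).union (h2.image fun x => (x, g x))).subset ?_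
    rintro p (⟨hp, h⟩ | ⟨hp, h⟩)
    · exact Or.inl ⟨p.1, hp, Prod.ext rfl h⟩
    · exact Or.inr ⟨p.1, hp, Prod.ext rfl h⟩
  have map_eq : ∀ {B B' : (lang n).Substructure M} {f g : M ≃[lang n] M},
      B.map f.toHom = B' → (∀ x ∈ B, g x = f x) → B.map g.toHom = B' := by
    rintro B _ f g rfl h
    ext x
    constructor
    · rintro ⟨b, hb, rfl⟩
      exact ⟨b, hb, (h b hb).symm⟩
    · rintro ⟨b, hb, rfl⟩
      exact ⟨b, hb, h b hb⟩
  constructor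
  · intro A B C _ _ _ g h
    exact signIndep_map hδ g h
  · intro A B C hA hB hC
    exact exists_signIndep_left hδ hM A B C hA hB hC
  -- instead of moving `B` by `f`, move `C` by `f⁻¹`
  · intro A B C hA hB hC
    obtain ⟨f, hf, h⟩ := exists_signIndep_left hδ hM A B C hA hB hC
    have hf' : ∀ a ∈ A, f.symm a = a := fun a ha => by
      conv_lhs => rw [← hf a ha]
      exact f.symm_apply_apply a
    refine ⟨f.symm, hf', ?_⟩
    have h' := signIndep_map hδ f.symm h
    rw [map_eq_self hf'] at h'
    convert! h' using 1
    ext x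
    constructor
    · exact fun hx => ⟨f x, ⟨x, hx, rfl⟩, f.symm_apply_apply x⟩
    · rintro ⟨_, ⟨y, hy, rfl⟩, rfl⟩
      rw [show f.symm.toHom (f.toHom y) = y from f.symm_apply_apply y]
      exact hy
  · intro A B B' C hA hB _ hC h h' f hf hfB
    obtain ⟨g, hg⟩ := exists_equiv_of_isPartialIso hM
      (fin f (FirstOrder.Language.Equiv.refl _ M) hA hB hC)
      (isPartialIso_of_signIndep hδ hAlt h h' hf (fun _ _ => rfl) hfB (map_eq_self fun _ _ => rfl))
    have h1 : ∀ x ∈ A ⊔ B, g x = f x := fun x hx => hg _ _ (Or.inl ⟨hx, rfl⟩)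
    exact ⟨g, fun x hx => hg _ _ (Or.inr ⟨hx, rfl⟩), h1,
      map_eq hfB fun x hx => h1 x (mem_sup_iff.2 (Or.inr hx))⟩
  · intro A B C C' hA hB hC _ h h' f hf hfC
    obtain ⟨g, hg⟩ := exists_equiv_of_isPartialIso hM
      (fin (FirstOrder.Language.Equiv.refl _ M) f hA hB hC)
      (isPartialIso_of_signIndep hδ hAlt h h' (fun _ _ => rfl) hf (map_eq_self fun _ _ => rfl) hfC)
    have h1 : ∀ x ∈ A ⊔ C, g x = f x := fun x hx => hg _ _ (Or.inr ⟨hx, rfl⟩)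
    exact ⟨g, fun x hx => hg _ _ (Or.inl ⟨hx, rfl⟩), h1,
      map_eq hfC fun x hx => h1 x (mem_sup_iff.2 (Or.inr hx))⟩
  all_goals
    intro A B C D _ _ _ _ h
    constructor <;> refine signIndep_mono hδ h ?_ ?_ ?_ <;> intro x hx <;>
      simp only [Set.mem_sdiff, Set.mem_union, SetLike.mem_coe, mem_sup_iff] at hx ⊢ <;> tauto

end SignIndep

/-! ### Existence of the generic hypertournament -/

section Existence

/-- The sign of a pair of natural numbers for the transitive tournament `<`. -/
def natSign (x y : ℕ) : ℤ := if x < y then 1 else -1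

theorem natSign_eq_one_or (x y : ℕ) : natSign x y = 1 ∨ natSign x y = -1 := by
  unfold natSign
  split_ifs <;> simp

theorem natSign_swap {x y : ℕ} (h : x ≠ y) : natSign y x = -natSign x y := by
  unfold natSign
  split_ifs <;> omega

/-- The hypertournament on the natural numbers coded by `code`. The sign of an increasing tuple with
last entry `m` is read off from whether `code m` contains the set of the other entries; reordering
the tuple multiplies the sign by that of the permutation, computed as a product over pairs. -/
@[reducible] def codedStructure (n : I → ℕ) (code : ℕ → Finset (I × Finset ℕ)) :
    (lang n).Structure (ULift.{w} ℕ) where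
  funMap := fun f => isEmptyElim (α := Empty) f
  RelMap := fun {k} r v => Function.Injective v ∧
    ((∏ p : Fin k × Fin k with p.1 < p.2, natSign (v p.1).down (v p.2).down = 1) ↔
      (r.1, (Finset.univ.image fun j => (v j).down).erase
        ((Finset.univ.image fun j => (v j).down).sup id)) ∈
          code ((Finset.univ.image fun j => (v j).down).sup id))

/-- A coding of the naturals that takes each value arbitrarily late. -/
theorem exists_code (I : Type v) [Finite I] : ∃ code : ℕ → Finset (I × Finset ℕ),
    ∀ (E : Finset (I × Finset ℕ)) (m₀ : ℕ), ∃ m, m₀ < m ∧ code m = E := by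
  obtain ⟨f, hf⟩ := exists_surjective_nat (Finset (I × Finset ℕ))
  refine ⟨fun m => f (Nat.unpair m).1, fun E m₀ => ?_⟩
  obtain ⟨k, rfl⟩ := hf E
  exact ⟨Nat.pair k (m₀ + 1), Nat.right_le_pair k (m₀ + 1), by simp⟩

theorem isAlternating_codedStructure (code : ℕ → Finset (I × Finset ℕ)) (i : I) :
    letI := codedStructure.{v, w} n code
    IsAlternating fun v : Fin (n i) → ULift.{w} ℕ => Structure.RelMap (sym n i) v := by
  refine ⟨fun v h => h.1, fun v hv j k hjk => ?_⟩
  have hv' : Function.Injective (v ∘ Equiv.swap j k) := hv.comp (Equiv.injective _)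
  have himg : (Finset.univ.image fun l => ((v ∘ Equiv.swap j k) l).down) =
      Finset.univ.image fun l => (v l).down := by
    ext x
    simp only [Finset.mem_image, Finset.mem_univ, true_and, Function.comp]
    exact ((Equiv.swap j k).surjective.exists (p := fun l => (v l).down = x)).symm
  have hv2 : Function.Injective fun l => (v l).down := ULift.down_injective.comp hv
  have h1 := prod_pairs_swap (τ := natSign) (fun x y h => natSign_swap h) hv2 hjk
  simp only [Structure.RelMap, hv, hv', himg, true_and]
  simp only [Function.comp] at h1 ⊢
  rw [h1]
  rcases prod_pairs_eq_one_or natSign_eq_one_or (fun l => (v l).down) with h | h <;>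
    simp only [h] <;> norm_num

theorem iff_iff_iff_self (a b : Prop) : a ↔ (b ↔ (a ↔ b)) := by
  by_cases ha : a <;> simp [ha]

theorem iff_iff_iff_cancel (a b c : Prop) : ((a ↔ c) ↔ (b ↔ c)) ↔ (a ↔ b) := by
  by_cases hc : c <;> simp [hc, not_iff_not]

/-- One-point extension property of the coded hypertournament: a suitable code describes how the new
point has to be related to the finitely many given ones. -/
theorem exists_insert_codedStructure [Finite I] {code : ℕ → Finset (I × Finset ℕ)}
    (hcode : ∀ (E : Finset (I × Finset ℕ)) (m₀ : ℕ), ∃ m, m₀ < m ∧ code m = E)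
    {A : Type*} [(lang n).Structure A]
    (hA : ∀ i, IsAlternating fun v : Fin (n i) → A => Structure.RelMap (sym n i) v) :
    letI := codedStructure.{v, w} n code
    ∀ s : Set (A × ULift.{w} ℕ), s.Finite → IsPartialIso n s → ∀ a, (∀ m, (a, m) ∉ s) →
      ∃ m, IsPartialIso n (insert (a, m) s) := by
  classical
  let _ := codedStructure.{v, w} n code
  have hN := isAlternating_codedStructure.{v, w} (n := n) code
  intro s hs hpi a ha
  cases nonempty_fintype I
  obtain ⟨m₀, hm₀⟩ : ∃ m₀, ∀ p ∈ s, p.2.down < m₀ := by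
    obtain ⟨b, hb⟩ := (hs.image fun p => p.2.down).bddAbove
    exact ⟨b + 1, fun p hp => Nat.lt_succ_of_le (hb ⟨p, hp, rfl⟩)⟩
  -- `m₀` stands in for the new point until its code is known
  let κ : A → ℕ := fun x => if h : ∃ m, (x, m) ∈ s then h.choose.down else m₀
  have hκs : ∀ x m, (x, m) ∈ s → κ x = m.down := by
    intro x m h
    have h' : ∃ m, (x, m) ∈ s := ⟨m, h⟩
    have : κ x = h'.choose.down := dif_pos h'
    rw [this, hpi.right_unique h'.choose_spec h]
  have hκa : κ a = m₀ := dif_neg fun ⟨m, h⟩ => ha m h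
  let S : Set A := {x | x = a ∨ ∃ m, (x, m) ∈ s}
  have hκ : Set.InjOn κ S := by
    rintro x (rfl | ⟨m, hm⟩) y (rfl | ⟨m', hm'⟩) h
    · rfl
    · rw [hκa, hκs y m' hm'] at h
      exact absurd (hm₀ _ hm') (by simp [h])
    · rw [hκa, hκs x m hm] at h
      exact absurd (hm₀ _ hm) (by simp [h])
    · rw [hκs x m hm, hκs y m' hm'] at h
      have h' : m = m' := ULift.down_injective h
      subst h'
      exact hpi.left_unique hm hm'
  -- the code: `(i, F)` belongs to it if `R_i` has to agree with the sign product for `<` on the set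
  -- `F` together with the new point
  let E : Finset (I × Finset ℕ) := (Finset.univ ×ˢ (Finset.range m₀).powerset).filter fun q =>
    ∃ v : Fin (n q.1) → A, Function.Injective v ∧ (∀ j, v j ∈ S) ∧
      (Finset.univ.image fun j => κ (v j)) = insert m₀ q.2 ∧
      (Structure.RelMap (sym n q.1) v ↔
        ∏ p : Fin _ × Fin _ with p.1 < p.2, natSign (κ (v p.1)) (κ (v p.2)) = 1)
  obtain ⟨m, hm, hmE⟩ := hcode E m₀
  refine ⟨⟨m⟩, isPartialIso_of_injective hA hN ?_ ?_⟩
  · have hne : ∀ p ∈ s, p.1 ≠ a ∧ p.2 ≠ ⟨m⟩ := by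
      intro p hp
      refine ⟨fun h => ha p.2 (h ▸ hp), fun h => ?_⟩
      have := hm₀ p hp
      rw [h] at this
      exact absurd this (by simpa using hm.le)
    rintro p (rfl | hp) q (rfl | hq)
    · simp
    · simp [(hne q hq).1.symm, (hne q hq).2.symm]
    · simp [hne p hp]
    · exact hpi.1 p hp q hq
  · intro i x b hx hb hxb
    by_cases hxa : ∃ j, x j = a
    swap
    · exact hpi.2 i x b fun j => (hxb j).resolve_left fun h => hxa ⟨j, congrArg Prod.fst h⟩
    obtain ⟨j₀, hj₀⟩ := hxa
    have hbj₀ : (b j₀).down = m := by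
      rcases hxb j₀ with h | h
      · exact congrArg ULift.down (congrArg Prod.snd h)
      · exact absurd (hj₀ ▸ h) (ha _)
    have hother : ∀ j, j ≠ j₀ → (x j, b j) ∈ s := fun j hj =>
      (hxb j).resolve_left fun h => hj (hx ((congrArg Prod.fst h).trans hj₀.symm))
    have hxS : ∀ j, x j ∈ S := by
      intro j
      by_cases hj : j = j₀
      · exact Or.inl (hj ▸ hj₀)
      · exact Or.inr ⟨_, hother j hj⟩
    have hbκ : ∀ j, j ≠ j₀ → (b j).down = κ (x j) ∧ (b j).down < m₀ := fun j hj =>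
      ⟨(hκs _ _ (hother j hj)).symm, hm₀ _ (hother j hj)⟩
    have hκj₀ : κ (x j₀) = m₀ := hj₀ ▸ hκa
    set F : Finset ℕ := (Finset.univ.erase j₀).image fun j => (b j).down with hF
    have hFlt : ∀ y ∈ F, y < m₀ := by
      intro y hy
      obtain ⟨j, hj, rfl⟩ := Finset.mem_image.1 hy
      exact (hbκ j (Finset.ne_of_mem_erase hj)).2
    have himg : (Finset.univ.image fun j => (b j).down) = insert m F := by
      rw [hF, ← hbj₀, ← Finset.image_insert fun j => (b j).down,
        Finset.insert_erase (Finset.mem_univ _)]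
    have himgκ : (Finset.univ.image fun j => κ (x j)) = insert m₀ F := by
      have : F = (Finset.univ.erase j₀).image fun j => κ (x j) :=
        Finset.image_congr fun j hj => (hbκ j (Finset.ne_of_mem_erase hj)).1
      rw [this, ← hκj₀, ← Finset.image_insert fun j => κ (x j),
        Finset.insert_erase (Finset.mem_univ _)]
    have hsup : (insert m F).sup id = m := by
      rw [Finset.sup_insert, id, sup_eq_left, Finset.sup_le_iff]
      exact fun y hy => ((hFlt y hy).trans hm).le
    have herase : (insert m F).erase m = F :=
      Finset.erase_insert fun h => lt_asymm (hFlt m h) hm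
    have hprod : ∏ p : Fin (n i) × Fin (n i) with p.1 < p.2, natSign (b p.1).down (b p.2).down =
        ∏ p : Fin (n i) × Fin (n i) with p.1 < p.2, natSign (κ (x p.1)) (κ (x p.2)) := by
      refine Finset.prod_congr rfl fun p hp => ?_
      have hne := (Finset.mem_filter.1 hp).2.ne
      unfold natSign
      congr 1
      by_cases h1 : p.1 = j₀
      · have h2 : p.2 ≠ j₀ := fun h => hne (h1.trans h.symm)
        have := hbκ _ h2
        rw [h1, hκj₀, hbj₀]
        apply propext
        omega
      · by_cases h2 : p.2 = j₀
        · have := hbκ _ h1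
          rw [h2, hκj₀, hbj₀]
          apply propext
          omega
        · rw [(hbκ _ h1).1, (hbκ _ h2).1]
    have hmem : (i, F) ∈ E ↔ (Structure.RelMap (sym n i) x ↔
        ∏ p : Fin (n i) × Fin (n i) with p.1 < p.2, natSign (κ (x p.1)) (κ (x p.2)) = 1) := by
      constructor
      · intro h
        obtain ⟨-, v, hv, hvS, hvF, hvR⟩ := Finset.mem_filter.1 h
        have hrange : Set.range v = Set.range x := by
          have h1 : ∀ y ∈ S, ∀ u : Fin (n i) → A, (∀ j, u j ∈ S) →
              (κ y ∈ (Finset.univ.image fun j => κ (u j)) ↔ y ∈ Set.range u) := by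
            intro y hy u hu
            simp only [Finset.mem_image, Finset.mem_univ, true_and, Set.mem_range]
            exact exists_congr fun j => ⟨fun h => hκ (hu j) hy h, fun h => h ▸ rfl⟩
          ext y
          constructor
          · rintro ⟨j, rfl⟩
            rw [← h1 _ (hvS j) x hxS, himgκ, ← hvF]
            exact Finset.mem_image_of_mem _ (Finset.mem_univ _)
          · rintro ⟨j, rfl⟩
            rw [← h1 _ (hxS j) v hvS, hvF, ← himgκ]
            exact Finset.mem_image_of_mem _ (Finset.mem_univ _)
        obtain ⟨σ, rfl⟩ := exists_perm_of_range_eq hx hv hrange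
        have hκx : Function.Injective fun j => κ (x j) := fun j k h =>
          hx (hκ (hxS j) (hxS k) h)
        have h2 := (isAlternating_prod_pairs natSign_eq_one_or
          fun _ _ h => natSign_swap h).comp_perm σ _ hκx
        have h3 := (hA i).comp_perm σ x hx
        have hκxσ : Function.Injective ((fun j => κ (x j)) ∘ σ) := hκx.comp σ.injective
        simp only [hκx, hκxσ, true_and] at h2
        simp only [Function.comp] at h2 h3 hvR
        rw [h2, h3] at hvR
        exact (iff_iff_iff_cancel _ _ _).1 hvR
      · intro h
        refine Finset.mem_filter.2 ⟨?_, x, hx, hxS, himgκ, h⟩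
        simp only [Finset.mem_product, Finset.mem_univ, true_and, Finset.mem_powerset]
        exact fun y hy => Finset.mem_range.2 (hFlt y hy)
    have hR : Structure.RelMap (sym n i) b ↔
        ((∏ p : Fin (n i) × Fin (n i) with p.1 < p.2, natSign (b p.1).down (b p.2).down = 1) ↔
          (i, F) ∈ E) := by
      change (Function.Injective b ∧ (_ ↔ (i, Finset.erase _ _) ∈ code _)) ↔ _
      rw [himg, hsup, herase, hmE]
      exact and_iff_right hb
    rw [hR, hmem, hprod]
    exact iff_iff_iff_self _ _

theorem isExtensionPair_codedStructure [Finite I] {code : ℕ → Finset (I × Finset ℕ)}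
    (hcode : ∀ (E : Finset (I × Finset ℕ)) (m₀ : ℕ), ∃ m, m₀ < m ∧ code m = E)
    {A : Type*} [(lang n).Structure A]
    (hA : ∀ i, IsAlternating fun v : Fin (n i) → A => Structure.RelMap (sym n i) v) :
    letI := codedStructure.{v, w} n code
    (lang n).IsExtensionPair A (ULift.{w} ℕ) := by
  let _ := codedStructure.{v, w} n code
  rw [isExtensionPair_iff_exists_embedding_closure_singleton_sup]
  intro S hS f a
  have hfin : Finite S := hS.finite
  let s : Set (A × ULift.{w} ℕ) := {p | ∃ h : p.1 ∈ S, f ⟨p.1, h⟩ = p.2}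
  have hs : s.Finite := by
    refine (Set.finite_range fun x : S => ((x : A), f x)).subset ?_
    rintro p ⟨h, hp⟩
    exact ⟨⟨p.1, h⟩, Prod.ext rfl hp⟩
  have hpi : IsPartialIso n s := by
    refine ⟨?_, ?_⟩
    · rintro p ⟨h, hp⟩ q ⟨h', hq⟩
      rw [← hp, ← hq, f.injective.eq_iff, Subtype.mk.injEq]
    · intro i x b hxb
      choose hx hb using hxb
      have hb' : (f ∘ fun j => ⟨x j, hx j⟩) = b := funext hb
      rw [← hb']
      exact (f.map_rel (sym n i) fun j => ⟨x j, hx j⟩).symm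
  obtain ⟨t, ht, hst, hat⟩ : ∃ t, IsPartialIso n t ∧ s ⊆ t ∧ ∃ m, (a, m) ∈ t := by
    by_cases ha : ∃ m, (a, m) ∈ s
    · exact ⟨s, hpi, subset_rfl, ha⟩
    · push Not at ha
      obtain ⟨m, hm⟩ := exists_insert_codedStructure hcode hA s hs hpi a ha
      exact ⟨_, hm, Set.subset_insert _ _, m, Set.mem_insert _ _⟩
  obtain ⟨g, hg⟩ := ht.exists_embedding (Substructure.closure (lang n) {a} ⊔ S) (by
    intro x hx
    rcases mem_sup_iff.1 hx with h | h
    · rw [Substructure.mem_closure_iff_of_isRelational, Set.mem_singleton_iff] at h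
      exact h ▸ hat
    · exact ⟨f ⟨x, h⟩, hst ⟨h, rfl⟩⟩)
  refine ⟨g, ?_⟩
  ext x
  have h1 : ((x : A), f x) ∈ s := ⟨x.2, rfl⟩
  exact congrArg ULift.down (ht.right_unique (hst h1)
    (hg (Substructure.inclusion le_sup_right x)))

theorem exists_isFraisseLimit [Finite I] (n : I → ℕ) (hn : ∀ i, 2 ≤ n i) :
    ∃ (M : Type w) (_ : (lang n).Structure M) (_ : Countable M),
      IsFraisseLimit (finiteHypertournaments.{v, w} n) M := by
  obtain ⟨code, hcode⟩ := exists_code I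
  let _ := codedStructure.{v, w} n code
  have hN := isAlternating_codedStructure.{v, w} (n := n) code
  refine ⟨ULift.{w} ℕ, inferInstance, inferInstance, ?_, ?_⟩
  · exact (isUltrahomogeneous_iff_IsExtensionPair Structure.cg_of_countable).2
      (isExtensionPair_codedStructure hcode hN)
  · ext A
    constructor
    · rintro ⟨hA, ⟨f⟩⟩
      refine ⟨hA.finite, fun i => isHypertournament_iff.2 ?_⟩
      have := (hN i).comp_injective f.injective
      convert! this using 2 with v
      exact (f.map_rel _ _).symm
    · rintro ⟨hA, hA'⟩
      have hA'' := fun i => isHypertournament_iff.1 (hA' i)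
      have : Finite A := hA
      have hfg : Structure.FG (lang n) A := Structure.fg_iff_finite.2 hA
      -- the empty embedding starts the extension process; it needs that no `R_i` is nullary
      obtain ⟨f, -⟩ := (show IsPartialIso n (∅ : Set (A × ULift.{w} ℕ)) from
        ⟨by simp, fun i x b h => (h ⟨0, zero_lt_two.trans_le (hn i)⟩).elim⟩).exists_embedding
        (⊥ : (lang n).Substructure A) (by
          intro a ha
          rw [← Substructure.closure_empty, Substructure.mem_closure_iff_of_isRelational] at ha
          exact ha.elim)
      obtain ⟨g, -⟩ := embedding_from_cg hfg.cg
        ⟨⟨⊥, f.toHom.range, f.equivRange⟩, Substructure.fg_bot⟩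
        (isExtensionPair_codedStructure hcode hA'')
      exact ⟨hfg, ⟨g⟩⟩

end Existence

/-! ### Joint one-point extensions -/

section Joint

variable {M : Type w} [(lang n).Structure M]

theorem IsPartialIso.rhoPair_eq {s : Set (M × M)} (hs : IsPartialIso n s) {δ : I} (hδ : n δ = 2)
    {x y x' y' : M} (hx : (x, x') ∈ s) (hy : (y, y') ∈ s) :
    rhoPair hδ x y = rhoPair hδ x' y' := by
  refine rho_congr (hs.2 δ _ _ fun k => ?_)
  generalize Fin.cast hδ k = l
  fin_cases l
  · exact hx
  · exact hy

theorem isPartialIso_id : IsPartialIso n {p : M × M | p.1 = p.2} :=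
  isPartialIso_graph (FirstOrder.Language.Equiv.refl (lang n) M)

theorem isPartialIso_empty : IsPartialIso n (∅ : Set (M × M)) :=
  isPartialIso_id.mono (Set.empty_subset _)

variable [Countable M]

/-- Two prescriptions for the type of a new point, over the domains of `k` and of `k'`, can be met
simultaneously as soon as they agree on the common part of the domains. Moreover the relation of the
new point to the remaining points of a finite set `S` may be prescribed. -/
theorem exists_insert_insert_of_rhoPair
    (hM : IsFraisseLimit (finiteHypertournaments.{v, w} n) M) {δ : I} (hδ : n δ = 2)
    {k k' : Set (M × M)} (hkf : k.Finite) (hkf' : k'.Finite) (hk : IsPartialIso n k)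
    (hk' : IsPartialIso n k') {u u' : M} (hu : ∀ x, (x, u) ∉ k) (hu' : ∀ x, (x, u') ∉ k')
    (hc : IsPartialIso n (insert (u, u') {p : M × M | ∃ x, (x, p.1) ∈ k ∧ (x, p.2) ∈ k'}))
    {S : Set M} (hS : S.Finite) (θ : M → Prop) :
    ∃ x, x ∉ S ∧ IsPartialIso n (insert (x, u) k) ∧ IsPartialIso n (insert (x, u') k') ∧
      ∀ y ∈ S, (∀ z, (y, z) ∉ k) → (∀ z, (y, z) ∉ k') → (rhoPair hδ x y = 1 ↔ θ y) := by
  classical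
  have hA := isAlternating_of_isFraisseLimit hM
  obtain ⟨α, hα⟩ := exists_equiv_of_isPartialIso hM hkf hk
  obtain ⟨α', hα'⟩ := exists_equiv_of_isPartialIso hM hkf' hk'
  let D : Set M := S ∪ Prod.fst '' k ∪ Prod.fst '' k'
  have hD : D.Finite := (hS.union (hkf.image _)).union (hkf'.image _)
  have : Finite D := hD
  have hkD : ∀ {x z}, (x, z) ∈ k → x ∈ D := fun h => Or.inl (Or.inr ⟨_, h, rfl⟩)
  have hkD' : ∀ {x z}, (x, z) ∈ k' → x ∈ D := fun h => Or.inr ⟨_, h, rfl⟩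
  have hdom : ∀ {x}, (∃ z, (x, z) ∈ k) → (x, α x) ∈ k := by
    rintro x ⟨z, hz⟩
    rwa [hα x z hz]
  have hdom' : ∀ {x}, (∃ z, (x, z) ∈ k') → (x, α' x) ∈ k' := by
    rintro x ⟨z, hz⟩
    rwa [hα' x z hz]
  -- the charts: the given points, the domain of `k` with `u`, the domain of `k'` with `u'`
  let φ : Option Bool → Option D → M
    | none, some w => w
    | none, none => u
    | some true, some w => α w
    | some true, none => u
    | some false, some w => α' w
    | some false, none => u'
  let U : Option Bool → Set (Option D)
    | none => {x | x.isSome}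
    | some true => {x | ∀ w ∈ x, ∃ z, ((w : M), z) ∈ k}
    | some false => {x | ∀ w ∈ x, ∃ z, ((w : M), z) ∈ k'}
  let t : M → ℤ := fun y => if ∃ z, (y, z) ∈ k then rhoPair hδ u (α y) else
    if ∃ z, (y, z) ∈ k' then rhoPair hδ u' (α' y) else if θ y then 1 else -1
  let τ : Option D → Option D → ℤ
    | none, none => 1
    | none, some y => t y
    | some x, none => -t x
    | some x, some y => rhoPair hδ (x : M) y
  have ht : ∀ y, t y = 1 ∨ t y = -1 := by
    intro y
    simp only [t]
    split_ifs
    · exact rhoPair_eq_one_or hδ _ _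
    · exact rhoPair_eq_one_or hδ _ _
    · simp
    · simp
  have hφ : ∀ c, Set.InjOn (φ c) (U c) := by
    rintro (_ | _ | _) (_ | x) hx (_ | y) hy h
    · rfl
    · exact absurd hx (by simp [U])
    · exact absurd hy (by simp [U])
    · exact congrArg some (Subtype.ext h)
    · rfl
    · exact absurd ((show u' = α' y from h) ▸ hdom' (hy y rfl)) (hu' _)
    · exact absurd ((show α' x = u' from h) ▸ hdom' (hx x rfl)) (hu' _)
    · exact congrArg some (Subtype.ext (α'.injective h))
    · rfl
    · exact absurd ((show u = α y from h) ▸ hdom (hy y rfl)) (hu _)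
    · exact absurd ((show α x = u from h) ▸ hdom (hx x rfl)) (hu _)
    · exact congrArg some (Subtype.ext (α.injective h))
  have htriv : ∀ c (i : I) (v : Fin (n i) → Option D), (∀ j, v j ∈ U none) →
      (Structure.RelMap (sym n i) (φ none ∘ v) ↔ Structure.RelMap (sym n i) (φ c ∘ v)) := by
    intro c i v hv
    have hv' : ∀ j, ∃ x, v j = some x := fun j => Option.isSome_iff_exists.1 (hv j)
    choose x hx using hv'
    obtain rfl : (fun j => some (x j)) = v := funext fun j => (hx j).symm
    rcases c with _ | _ | _
    · rfl
    · exact (α'.map_rel (sym n i) fun j => (x j : M)).symm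
    · exact (α.map_rel (sym n i) fun j => (x j : M)).symm
  have hmix : ∀ (i : I) (v : Fin (n i) → Option D), (∀ j, v j ∈ U (some true)) →
      (∀ j, v j ∈ U (some false)) → (Structure.RelMap (sym n i) (φ (some true) ∘ v) ↔
        Structure.RelMap (sym n i) (φ (some false) ∘ v)) := by
    intro i v hv hv'
    refine hc.2 i _ _ fun j => ?_
    have h1 := hv j
    have h2 := hv' j
    simp only [Function.comp]
    generalize v j = y at h1 h2
    rcases y with _ | y
    · exact Set.mem_insert _ _
    · exact Or.inr ⟨y, hdom (h1 y rfl), hdom' (h2 y rfl)⟩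
  obtain ⟨e, he, he1, he2, he3, -⟩ := exists_realization_of_charts hM hδ U φ hφ (by
      rintro (_ | _ | _) (_ | _ | _) i v - hv hv'
      · rfl
      · exact htriv _ i v hv
      · exact htriv _ i v hv
      · exact (htriv _ i v hv').symm
      · rfl
      · exact (hmix i v hv' hv).symm
      · exact (htriv _ i v hv').symm
      · exact hmix i v hv hv'
      · rfl) τ (by
      rintro (_ | x) (_ | y)
      · simp [τ]
      · exact ht y
      · rcases ht x with h | h <;> simp [τ, h]
      · exact rhoPair_eq_one_or hδ _ _) (by
      rintro (_ | x) (_ | y) hxy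
      · exact absurd rfl hxy
      · rfl
      · simp [τ]
      · exact rhoPair_swap hδ (hA δ) fun h => hxy (congrArg some (Subtype.ext h))) (by
      have h1 : ∀ y : D, (∃ z, ((y : M), z) ∈ k) → t y = rhoPair hδ u (α y) :=
        fun y h => if_pos h
      have h2 : ∀ y : D, (∃ z, ((y : M), z) ∈ k') → t y = rhoPair hδ u' (α' y) := by
        intro y h
        by_cases h' : ∃ z, ((y : M), z) ∈ k
        · rw [h1 y h']
          exact hc.rhoPair_eq hδ (Set.mem_insert _ _) (Or.inr ⟨y, hdom h', hdom' h⟩)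
        · simp [t, h, h']
      rintro (_ | _ | _) (_ | x) hx (_ | y) hy hxy
      any_goals exact absurd rfl hxy
      · exact absurd hx (by simp [U])
      · exact absurd hy (by simp [U])
      · rfl
      · exact h2 y (hy y rfl)
      · simp only [τ]
        rw [h2 x (hx x rfl), rhoPair_swap hδ (hA δ), neg_neg]
        exact fun h => hu' _ (h ▸ hdom' (hx x rfl))
      · exact (rhoPair_map hδ α' _ _).symm
      · exact h1 y (hy y rfl)
      · simp only [τ]
        rw [h1 x (hx x rfl), rhoPair_swap hδ (hA δ), neg_neg]
        exact fun h => hu _ (h ▸ hdom (hx x rfl))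
      · exact (rhoPair_map hδ α _ _).symm) none
  have he1' : ∀ y : D, e (some y) = y := fun y => he1 (some y) rfl
  have hpi : ∀ c, IsPartialIso n {p : M × M | ∃ w ∈ U c, e w = p.1 ∧ φ c w = p.2} := by
    intro c
    refine isPartialIso_of_injective hA hA ?_ ?_
    · rintro p ⟨x, hx, h1, h2⟩ q ⟨y, hy, h3, h4⟩
      rw [← h1, ← h2, ← h3, ← h4, he.eq_iff, (hφ c).eq_iff hx hy]
    · intro i a b ha hb hab
      choose x hx h1 h2 using hab
      obtain rfl : e ∘ x = a := funext h1
      obtain rfl : φ c ∘ x = b := funext h2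
      exact he2 c i x ha.of_comp hx
  refine ⟨e none, ?_, (hpi (some true)).mono ?_, (hpi (some false)).mono ?_, ?_⟩
  · intro h
    exact absurd (he (he1' ⟨e none, Or.inl (Or.inl h)⟩)) (by simp)
  · rintro p (rfl | hp)
    · exact ⟨none, by simp [U], rfl, rfl⟩
    · refine ⟨some ⟨p.1, hkD hp⟩, ?_, he1' _, hα _ _ hp⟩
      rintro w hw
      cases hw
      exact ⟨_, hp⟩
  · rintro p (rfl | hp)
    · exact ⟨none, by simp [U], rfl, rfl⟩
    · refine ⟨some ⟨p.1, hkD' hp⟩, ?_, he1' _, hα' _ _ hp⟩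
      rintro w hw
      cases hw
      exact ⟨_, hp⟩
  · intro y hy hyk hyk'
    have h := he3 none (some ⟨y, Or.inl (Or.inl hy)⟩) (by simp)
    rw [he1'] at h
    have h' : rhoPair hδ (e none) y = if θ y then 1 else -1 := by
      rw [h]
      simp [τ, t, hyk, hyk']
    rw [h']
    split_ifs with hθ <;> simp [hθ]

/-- A nontrivial automorphism moves points outside any finite set, since points that are related
differently to `c` and `g c` are moved. -/
theorem exists_moved_notMem (hM : IsFraisseLimit (finiteHypertournaments.{v, w} n) M)
    {δ : I} (hδ : n δ = 2) {g : M ≃[lang n] M} (hg : ∃ c, g c ≠ c) {S : Set M} (hS : S.Finite) :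
    ∃ c, c ∉ S ∧ g c ∉ S ∧ g c ≠ c := by
  obtain ⟨c, hc⟩ := hg
  obtain ⟨x, hx, -, -, hθ⟩ := exists_insert_insert_of_rhoPair hM hδ
    (u := c) (u' := c) Set.finite_empty Set.finite_empty isPartialIso_empty isPartialIso_empty
    (by simp) (by simp)
    (isPartialIso_id.mono (by rintro p (rfl | ⟨x, h, -⟩); exacts [rfl, h.elim]))
    (S := insert c (insert (g c) (S ∪ g ⁻¹' S)))
    (((hS.union (hS.preimage g.injective.injOn)).insert _).insert _) (fun y => y = c)
  refine ⟨x, fun h => hx (by simp [h]), fun h => hx (by simp [h]), fun h => ?_⟩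
  have h1 := (hθ c (by simp) (by simp) (by simp)).2 rfl
  rw [← rhoPair_map hδ g, h] at h1
  exact hc ((hθ (g c) (by simp) (by simp) (by simp)).1 h1)

/-- Joint one-point extensions by a point that is moved by a given nontrivial automorphism. -/
theorem exists_insert_insert (hM : IsFraisseLimit (finiteHypertournaments.{v, w} n) M)
    {δ : I} (hδ : n δ = 2) {g : M ≃[lang n] M} (hg : ∃ c, g c ≠ c)
    {k k' : Set (M × M)} (hkf : k.Finite) (hkf' : k'.Finite) (hk : IsPartialIso n k)
    (hk' : IsPartialIso n k') {u u' : M} (hu : ∀ x, (x, u) ∉ k) (hu' : ∀ x, (x, u') ∉ k')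
    (hc : IsPartialIso n (insert (u, u') {p : M × M | ∃ x, (x, p.1) ∈ k ∧ (x, p.2) ∈ k'}))
    {S : Set M} (hS : S.Finite) :
    ∃ x, x ∉ S ∧ g x ≠ x ∧ IsPartialIso n (insert (x, u) k) ∧
      IsPartialIso n (insert (x, u') k') := by
  obtain ⟨c, hcS, hgcS, hgc⟩ := exists_moved_notMem hM hδ hg
    ((hkf.image Prod.fst).union (hkf'.image Prod.fst))
  have hmem : ∀ y, y ∉ Prod.fst '' k ∪ Prod.fst '' k' →
      (∀ z, (y, z) ∉ k) ∧ ∀ z, (y, z) ∉ k' := fun y hy =>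
    ⟨fun z h => hy (Or.inl ⟨_, h, rfl⟩), fun z h => hy (Or.inr ⟨_, h, rfl⟩)⟩
  obtain ⟨x, hx, h1, h2, hθ⟩ := exists_insert_insert_of_rhoPair hM hδ hkf hkf' hk hk' hu hu' hc
    (S := insert c (insert (g c) S)) ((hS.insert _).insert _) (fun y => y = c)
  refine ⟨x, fun h => hx (by simp [h]), fun h => ?_, h1, h2⟩
  have h3 := (hθ c (by simp) (hmem _ hcS).1 (hmem _ hcS).2).2 rfl
  rw [← rhoPair_map hδ g, h] at h3
  exact hgc ((hθ (g c) (by simp) (hmem _ hgcS).1 (hmem _ hgcS).2).1 h3)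

theorem exists_insert (hM : IsFraisseLimit (finiteHypertournaments.{v, w} n) M)
    {δ : I} (hδ : n δ = 2) {g : M ≃[lang n] M} (hg : ∃ c, g c ≠ c)
    {k : Set (M × M)} (hkf : k.Finite) (hk : IsPartialIso n k) {u : M} (hu : ∀ x, (x, u) ∉ k)
    {S : Set M} (hS : S.Finite) :
    ∃ x, x ∉ S ∧ g x ≠ x ∧ IsPartialIso n (insert (x, u) k) := by
  obtain ⟨x, h1, h2, h3, -⟩ := exists_insert_insert hM hδ hg hkf hkf hk hk hu hu
    (isPartialIso_id.mono (by
      rintro p (rfl | ⟨x, h1, h2⟩)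
      · rfl
      · exact hk.right_unique h1 h2)) hS
  exact ⟨x, h1, h2, h3⟩

end Joint

/-! ### Automorphisms as limits of finite partial isomorphisms -/

section Limit

variable {M : Type w} [(lang n).Structure M]

/-- An increasing union of partial isomorphisms that is total and onto is an automorphism. -/
theorem exists_equiv_of_monotone {s : ℕ → Set (M × M)} (hs : Monotone s)
    (hpi : ∀ j, IsPartialIso n (s j)) (hdom : ∀ x, ∃ j y, (x, y) ∈ s j)
    (hran : ∀ y, ∃ j x, (x, y) ∈ s j) :
    ∃ g : M ≃[lang n] M, ∀ x y, g x = y ↔ ∃ j, (x, y) ∈ s j := by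
  have hU : IsPartialIso n (⋃ j, s j) := by
    refine ⟨fun p hp q hq => ?_, fun i a b hab => ?_⟩
    · obtain ⟨j, hj⟩ := Set.mem_iUnion.1 hp
      obtain ⟨k, hk⟩ := Set.mem_iUnion.1 hq
      exact (hpi (max j k)).1 p (hs (le_max_left _ _) hj) q (hs (le_max_right _ _) hk)
    · simp only [Set.mem_iUnion] at hab
      choose j hj using hab
      obtain ⟨m, hm⟩ := (Set.finite_range j).bddAbove
      exact (hpi m).2 i a b fun k => hs (hm (Set.mem_range_self k)) (hj k)
  have mem : ∀ {p : M × M} {j}, p ∈ s j → p ∈ ⋃ j, s j := fun h => Set.mem_iUnion.2 ⟨_, h⟩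
  choose j f hf using hdom
  choose j' f' hf' using hran
  refine ⟨⟨⟨f, f', fun x => hU.left_unique (mem (hf' (f x))) (mem (hf x)),
    fun y => hU.right_unique (mem (hf (f' y))) (mem (hf' y))⟩,
    fun c => isEmptyElim (α := Empty) c, ?_⟩, fun x y => ⟨?_, ?_⟩⟩
  · rintro _ ⟨i, rfl⟩ v
    exact (hU.2 i v (f ∘ v) fun k => mem (hf (v k))).symm
  · rintro rfl
    exact ⟨_, hf x⟩
  · rintro ⟨k, hk⟩
    exact hU.right_unique (mem (hf x)) (mem hk)

/-- An automorphism has no orbit with exactly two points, since `R_δ` is antisymmetric. -/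
theorem apply_apply_ne {δ : I} (hδ : n δ = 2)
    (hA : IsAlternating fun v : Fin (n δ) → M => Structure.RelMap (sym n δ) v)
    {g : M ≃[lang n] M} {x : M} (hx : g x ≠ x) : g (g x) ≠ x := by
  intro h
  have h1 := rhoPair_map hδ g x (g x)
  rw [h, rhoPair_swap hδ hA hx.symm] at h1
  rcases rhoPair_eq_one_or hδ x (g x) with h2 | h2 <;> rw [h2] at h1 <;> norm_num at h1

theorem IsPartialIso.conj {s : Set (M × M)} (hs : IsPartialIso n s) (g : M ≃[lang n] M) :
    IsPartialIso n {p : M × M | (g p.1, g p.2) ∈ s} :=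
  ((hs.map_left g).map_right g.symm).mono fun p hp => ⟨g p.2, hp, g.symm_apply_apply _⟩

end Limit

/-! ### Rich automorphisms -/

section Rich

variable {M : Type w} [(lang n).Structure M]

/-- The part of `k⁻¹ F k` that is already determined by the partial map `k`. -/
def edges (F : M ≃[lang n] M) (k : Set (M × M)) : Set (M × M) :=
  {p | ∃ u, (p.1, u) ∈ k ∧ (p.2, F u) ∈ k}

/-- An automorphism is rich if it has no finite orbits and, for every finite partial isomorphism `k`,
each edge `x ↦ y` that can be added to the determined part of `k⁻¹ F k` is realized by an extension
of `k`, sending `x` and `y` to new orbits. -/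
structure IsRich (F : M ≃[lang n] M) : Prop where
  pow_ne : ∀ m : ℕ, 0 < m → ∀ x, (F ^ m) x ≠ x
  exists_edge : ∀ k : Set (M × M), k.Finite → IsPartialIso n k → ∀ x y, x ≠ y →
    (∀ u, (x, u) ∉ k) → (∀ u, (y, u) ∉ k) → IsPartialIso n (insert (x, y) (edges F k)) →
    ∀ S : Set M, S.Finite → ∃ u, (∀ m : ℤ, (F ^ m) u ∉ S) ∧
      IsPartialIso n (insert (x, u) (insert (y, F u) k))

/-- The part of the commutator `F = g⁻¹ h⁻¹ g h` that is determined by a partial map `h`. -/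
def commEdges (g : M ≃[lang n] M) (h : Set (M × M)) : Set (M × M) :=
  {p | ∃ u, (p.1, u) ∈ h ∧ (g p.2, g u) ∈ h}

theorem IsPartialIso.commEdges {h : Set (M × M)} (hh : IsPartialIso n h) (g : M ≃[lang n] M) :
    IsPartialIso n (commEdges g h) :=
  hh.comp (hh.conj g).inv

/-- The label of the image of a point with a given label. A label consists of a name for the orbit
and the position inside the orbit. -/
def nextLabel (l : ℕ × ℤ) : ℕ × ℤ := (l.1, l.2 + 1)

/-- A finite approximation to an automorphism `h` for which `g⁻¹ h⁻¹ g h` is rich: a finite partial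
isomorphism and labels on a finite set `dom` of points, such that the determined part of the
commutator moves labels forward. The values of `label` off `dom` are irrelevant. -/
structure Approx (g : M ≃[lang n] M) where
  /-- the approximation to `h` -/
  map : Set (M × M)
  /-- the label function -/
  label : M → ℕ × ℤ
  /-- the set of points whose label is fixed -/
  dom : Set M
  finite_map : map.Finite
  finite_dom : dom.Finite
  isPartialIso : IsPartialIso n map
  edge : ∀ x b, (x, b) ∈ commEdges g map →
    x ∈ dom ∧ b ∈ dom ∧ label b = nextLabel (label x)

instance (g : M ≃[lang n] M) : Preorder (Approx g) where
  le p q := p.map ⊆ q.map ∧ p.dom ⊆ q.dom ∧ ∀ x ∈ p.dom, q.label x = p.label x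
  le_refl p := ⟨subset_rfl, subset_rfl, fun _ _ => rfl⟩
  le_trans p q r h h' := ⟨h.1.trans h'.1, h.2.1.trans h'.2.1, fun x hx =>
    (h'.2.2 x (h.2.1 hx)).trans (h.2.2 x hx)⟩

theorem zpow_apply_label {F : M ≃[lang n] M} {c : M → ℕ × ℤ}
    (hc : ∀ x, c (F x) = nextLabel (c x)) (m : ℤ) (x : M) :
    c ((F ^ m) x) = ((c x).1, (c x).2 + m) := by
  have h : ∀ m : ℤ, c ((F ^ (1 + m)) x) = nextLabel (c ((F ^ m) x)) := fun m => by
    rw [zpow_one_add]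
    exact hc _
  induction m with
  | zero => simp; rfl
  | succ m ih => rw [add_comm, h, ih, nextLabel, add_assoc, add_comm (1 : ℤ)]
  | pred m ih =>
    have h' := h (-m - 1)
    rw [add_sub_cancel, ih] at h'
    simp only [nextLabel, Prod.mk.injEq] at h'
    refine Prod.ext h'.1.symm ?_
    simp only
    omega

variable [Countable M]

/-- A new value `u` of the approximation can be taken so generic that no new edge arises. -/
theorem Approx.exists_mem_domain (hM : IsFraisseLimit (finiteHypertournaments.{v, w} n) M)
    {δ : I} (hδ : n δ = 2) {g : M ≃[lang n] M} (hg : ∃ c, g c ≠ c) (p : Approx g) (x : M) :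
    ∃ q : Approx g, p ≤ q ∧ ∃ u, (x, u) ∈ q.map := by
  by_cases hx : ∃ u, (x, u) ∈ p.map
  · exact ⟨p, le_rfl, hx⟩
  push Not at hx
  set R := Prod.snd '' p.map with hR
  have hRf : R.Finite := p.finite_map.image _
  have memR : ∀ {z u}, (z, u) ∈ p.map → u ∈ R := fun h => ⟨_, h, rfl⟩
  obtain ⟨u, huS, hgu, hpi⟩ := exists_insert hM hδ hg (k := {q : M × M | (q.2, q.1) ∈ p.map})
    (p.finite_map.preimage Prod.swap_injective.injOn) p.isPartialIso.inv hx
    (S := R ∪ g ⁻¹' R ∪ g '' R)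
    ((hRf.union (hRf.preimage g.injective.injOn)).union (hRf.image _))
  have hpi' : IsPartialIso n (insert (x, u) p.map) := hpi.inv.mono (by
    rintro q (rfl | hq)
    · exact Or.inl rfl
    · exact Or.inr hq)
  refine ⟨⟨insert (x, u) p.map, p.label, p.dom, p.finite_map.insert _, p.finite_dom, hpi', ?_⟩,
    ⟨Set.subset_insert _ _, subset_rfl, fun _ _ => rfl⟩, u, Set.mem_insert _ _⟩
  rintro y b ⟨u₁, h1, h2⟩
  simp only [Set.mem_insert_iff, Prod.mk.injEq] at h1 h2
  rcases h1 with ⟨rfl, rfl⟩ | h1 <;> rcases h2 with ⟨h2, h3⟩ | h2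
  · exact absurd h3 hgu
  · exact absurd (Or.inl (Or.inr (memR h2))) huS
  · exact absurd (Or.inr ⟨u₁, memR h1, h3⟩) huS
  · exact p.edge y b ⟨u₁, h1, h2⟩

/-- When `u` is added to the range, with a new preimage `x`, edges that leave `x` and edges that
enter `g⁻¹ x` may arise. Both points are fresh, so that their labels can be chosen to fit. -/
theorem Approx.exists_mem_range (hM : IsFraisseLimit (finiteHypertournaments.{v, w} n) M)
    {δ : I} (hδ : n δ = 2) {g : M ≃[lang n] M} (hg : ∃ c, g c ≠ c) (p : Approx g) (u : M) :
    ∃ q : Approx g, p ≤ q ∧ ∃ x, (x, u) ∈ q.map := by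
  classical
  by_cases hu : ∃ x, (x, u) ∈ p.map
  · exact ⟨p, le_rfl, hu⟩
  push Not at hu
  set X := Prod.fst '' p.map with hX
  have hXf : X.Finite := p.finite_map.image _
  have memX : ∀ {z u}, (z, u) ∈ p.map → z ∈ X := fun h => ⟨_, h, rfl⟩
  set L := p.dom ∪ X ∪ g ⁻¹' X with hL
  have hLf : L.Finite := (p.finite_dom.union hXf).union (hXf.preimage g.injective.injOn)
  obtain ⟨x, hxS, hgx, hpi⟩ := exists_insert hM hδ hg p.finite_map p.isPartialIso hu
    (S := L ∪ g '' L) (hLf.union (hLf.image _))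
  have hxL : x ∉ L := fun h => hxS (Or.inl h)
  set x' := g.symm x with hx'
  have hgx' : g x' = x := g.apply_symm_apply x
  have hx'L : x' ∉ L := fun h => hxS (Or.inr ⟨x', h, hgx'⟩)
  have hxx' : x' ≠ x := fun h => hgx (by rw [← h, hgx', h])
  -- labels for the two new points `x` and `g⁻¹ x`
  obtain ⟨A, B, h1, h2, h3⟩ : ∃ A B : ℕ × ℤ, (g u = u → B = nextLabel A) ∧
      (∀ z, (g z, g u) ∈ p.map → p.label z = nextLabel A) ∧
      ∀ z u₁, (z, u₁) ∈ p.map → g u₁ = u → B = nextLabel (p.label z) := by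
    by_cases hgu : g u = u
    · refine ⟨0, nextLabel 0, fun _ => rfl, fun z hz => absurd (hgu ▸ hz) (hu _),
        fun z u₁ hz h => ?_⟩
      exact absurd (g.injective (h.trans hgu.symm) ▸ hz) (hu _)
    · obtain ⟨A, hA⟩ : ∃ A, ∀ z, (g z, g u) ∈ p.map → p.label z = nextLabel A := by
        by_cases h : ∃ z, (g z, g u) ∈ p.map
        · obtain ⟨z, hz⟩ := h
          refine ⟨((p.label z).1, (p.label z).2 - 1), fun z' hz' => ?_⟩
          rw [g.injective (p.isPartialIso.left_unique hz' hz)]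
          simp [nextLabel]
        · exact ⟨0, fun z hz => absurd ⟨z, hz⟩ h⟩
      obtain ⟨B, hB⟩ : ∃ B, ∀ z u₁, (z, u₁) ∈ p.map → g u₁ = u → B = nextLabel (p.label z) := by
        by_cases h : ∃ z u₁, (z, u₁) ∈ p.map ∧ g u₁ = u
        · obtain ⟨z, u₁, hz, hu₁⟩ := h
          refine ⟨nextLabel (p.label z), fun z' u₂ hz' hu₂ => ?_⟩
          obtain rfl := g.injective (hu₁.trans hu₂.symm)
          rw [p.isPartialIso.left_unique hz' hz]
        · exact ⟨0, fun z u₁ hz h' => absurd ⟨z, u₁, hz, h'⟩ h⟩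
      exact ⟨A, B, fun h => absurd h hgu, hA, hB⟩
  let c : M → ℕ × ℤ := fun y => if y = x then A else if y = x' then B else p.label y
  have hcx : c x = A := if_pos rfl
  have hcx' : c x' = B := by simp only [c, if_neg hxx', if_true]
  have hcL : ∀ y ∈ L, c y = p.label y := by
    intro y hy
    have e1 : y ≠ x := fun h => hxL (h ▸ hy)
    have e2 : y ≠ x' := fun h => hx'L (h ▸ hy)
    simp only [c, if_neg e1, if_neg e2]
  refine ⟨⟨insert (x, u) p.map, c, insert x (insert x' L), p.finite_map.insert _,
    (hLf.insert _).insert _, hpi, ?_⟩, ⟨Set.subset_insert _ _, fun y hy =>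
      Or.inr (Or.inr (Or.inl (Or.inl hy))), fun y hy => hcL y (Or.inl (Or.inl hy))⟩,
    x, Set.mem_insert _ _⟩
  rintro y b ⟨u₁, h4, h5⟩
  simp only [Set.mem_insert_iff, Prod.mk.injEq] at h4 h5
  have hb : g b = x → b = x' := fun h => g.injective (h.trans hgx'.symm)
  rcases h4 with ⟨rfl, rfl⟩ | h4 <;> rcases h5 with ⟨h5, h6⟩ | h5
  · rw [hb h5, hcx', hcx]
    exact ⟨Or.inl rfl, Or.inr (Or.inl rfl), h1 h6⟩
  · have hbL : b ∈ L := Or.inr (memX h5)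
    rw [hcL b hbL, hcx]
    exact ⟨Or.inl rfl, Or.inr (Or.inr hbL), h2 b h5⟩
  · have hyL : y ∈ L := Or.inl (Or.inr (memX h4))
    rw [hb h5, hcx', hcL y hyL]
    exact ⟨Or.inr (Or.inr hyL), Or.inr (Or.inl rfl), h3 y u₁ h4 h6⟩
  · obtain ⟨h7, h8, h9⟩ := p.edge y b ⟨u₁, h4, h5⟩
    rw [hcL y (Or.inl (Or.inl h7)), hcL b (Or.inl (Or.inl h8))]
    exact ⟨Or.inr (Or.inr (Or.inl (Or.inl h7))), Or.inr (Or.inr (Or.inl (Or.inl h8))), h9⟩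

/-- An edge `a ↦ b` in which `(a, b)` has the type of `(a₀, b₀)` over `Z` can be added to the
commutator, in a new orbit with name `N`. The points `a`, `u = h a` and `b`, with `h (g b) = g u`,
are chosen in this order. -/
theorem Approx.exists_edge (hM : IsFraisseLimit (finiteHypertournaments.{v, w} n) M)
    {δ : I} (hδ : n δ = 2) {g : M ≃[lang n] M} (hg : ∃ c, g c ≠ c) (p : Approx g) {Z : Set M}
    (hZ : Z.Finite) {a₀ b₀ : M} (hne : a₀ ≠ b₀) (ha₀ : a₀ ∉ Z) (hb₀ : b₀ ∉ Z)
    (hpi : IsPartialIso n (insert (a₀, b₀)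
      {q : M × M | q.1 ∈ Z ∧ q.2 ∈ Z ∧ q ∈ commEdges g p.map})) (N : ℕ) :
    ∃ q : Approx g, p ≤ q ∧ ∃ a b, (a, b) ∈ commEdges g q.map ∧ (q.label a).1 = N ∧
      IsPartialIso n (insert (a, a₀) (insert (b, b₀) {q : M × M | q.1 = q.2 ∧ q.1 ∈ Z})) := by
  classical
  have hA := isAlternating_of_isFraisseLimit hM
  set X := Prod.fst '' p.map with hX
  have hXf : X.Finite := p.finite_map.image _
  have memX : ∀ {z u}, (z, u) ∈ p.map → z ∈ X := fun h => ⟨_, h, rfl⟩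
  set R := Prod.snd '' p.map with hR
  have hRf : R.Finite := p.finite_map.image _
  have memR : ∀ {z u}, (z, u) ∈ p.map → u ∈ R := fun h => ⟨_, h, rfl⟩
  have hidf : {q : M × M | q.1 = q.2 ∧ q.1 ∈ Z}.Finite :=
    (hZ.image fun z => (z, z)).subset fun q hq => ⟨q.1, hq.2, Prod.ext rfl hq.1⟩
  have hidpi : IsPartialIso n {q : M × M | q.1 = q.2 ∧ q.1 ∈ Z} :=
    isPartialIso_id.mono fun q hq => hq.1
  have hpre : ∀ {Y : Set M}, Y.Finite → (g ⁻¹' Y).Finite := fun h =>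
    h.preimage g.injective.injOn
  -- `a` has the type of `a₀` over `Z`; over the points which the determined part of the commutator
  -- sends into `Z` it has the type that is carried to that of `b₀`
  obtain ⟨a, haS, hga, hpa, hpa'⟩ := exists_insert_insert hM hδ hg hidf
    (k' := {q : M × M | q ∈ commEdges g p.map ∧ q.2 ∈ Z}) (u := a₀) (u' := b₀) (by
      refine (hXf.prod hZ).subset ?_
      rintro q ⟨⟨u, h1, -⟩, h2⟩
      exact ⟨memX h1, h2⟩) hidpi
    ((p.isPartialIso.commEdges g).mono fun q hq => hq.1)
    (fun x hx => ha₀ ((show x = a₀ from hx.1) ▸ hx.2)) (fun x hx => hb₀ hx.2) (hpi.mono (by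
      rintro q (rfl | ⟨x, ⟨h1, h2⟩, h3, h4⟩)
      · exact Or.inl rfl
      · obtain rfl : x = q.1 := h1
        exact Or.inr ⟨h2, h4, h3⟩)) (S := X ∪ g ⁻¹' X ∪ g '' Z ∪ p.dom)
    (((hXf.union (hpre hXf)).union (hZ.image _)).union p.finite_dom)
  have haX : a ∉ X := fun h => haS (Or.inl (Or.inl (Or.inl h)))
  have hgaX : g a ∉ X := fun h => haS (Or.inl (Or.inl (Or.inr h)))
  have haZ : ∀ z ∈ Z, g z ≠ a := fun z hz h => haS (Or.inl (Or.inr ⟨z, hz, h⟩))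
  have haL : a ∉ p.dom := fun h => haS (Or.inr h)
  -- `u` is a possible value at `a`, and `g u` a possible value at `g b` if `b` has the type of `b₀`
  obtain ⟨u, huS, hgu, hpu, hpu'⟩ := exists_insert_insert hM hδ hg
    (k := {q : M × M | (q.2, q.1) ∈ p.map})
    (k' := {q : M × M | q.2 ∈ Z ∧ (g q.2, g q.1) ∈ p.map}) (u := a) (u' := b₀)
    (p.finite_map.preimage Prod.swap_injective.injOn)
    (((hpre hRf).prod hZ).subset fun q hq => ⟨memR hq.2, hq.1⟩) p.isPartialIso.inv
    ((p.isPartialIso.conj g).inv.mono fun q hq => hq.2) (fun x hx => haX (memX hx))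
    (fun x hx => hb₀ hx.1) (hpa'.mono (by
      rintro q (rfl | ⟨x, h1, h2, h3⟩)
      · exact Or.inl rfl
      · exact Or.inr ⟨⟨x, h1, h3⟩, h2⟩)) (S := R ∪ g ⁻¹' R ∪ g '' R ∪ g ⁻¹' (g ⁻¹' R))
    (((hRf.union (hpre hRf)).union (hRf.image _)).union (hpre (hpre hRf)))
  have huR : u ∉ R := fun h => huS (Or.inl (Or.inl (Or.inl h)))
  have hguR : g u ∉ R := fun h => huS (Or.inl (Or.inl (Or.inr h)))
  have huR' : ∀ r ∈ R, g r ≠ u := fun r hr h => huS (Or.inl (Or.inr ⟨r, hr, h⟩))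
  have hgguR : g (g u) ∉ R := fun h => huS (Or.inr h)
  -- `b` has the type of `b₀` over `Z` and `a`, and `g u` is a possible value at `g b`
  obtain ⟨b, hbS, -, hpb, hpb'⟩ := exists_insert_insert hM hδ hg
    (k := insert (a, a₀) {q : M × M | q.1 = q.2 ∧ q.1 ∈ Z})
    (k' := {q : M × M | (g q.1, q.2) ∈ insert (a, u) p.map}) (u := b₀) (u' := g u)
    (hidf.insert _) ((p.finite_map.insert (a, u)).preimage (f := fun q : M × M => (g q.1, q.2))
      (fun q _ q' _ h => Prod.ext (g.injective (Prod.mk.inj h).1) (Prod.mk.inj h).2)) hpa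
    ((hpu.inv.mono (by
      rintro q (rfl | hq)
      · exact Or.inl rfl
      · exact Or.inr hq) : IsPartialIso n (insert (a, u) p.map)).map_left g)
    (by
      rintro x (h | ⟨h1, h2⟩)
      · exact hne (congrArg Prod.snd h).symm
      · exact hb₀ ((show x = b₀ from h1) ▸ h2))
    (by
      rintro x (h | h)
      · exact hgu (congrArg Prod.snd h)
      · exact hguR (memR h)) ((hpu'.inv.map_right g).mono (by
      rintro ⟨q, q'⟩ (h | ⟨x, h1 | ⟨h1, h2⟩, h3 | h3⟩)
      · simp only [Prod.mk.injEq] at h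
        exact ⟨u, Or.inl (by rw [h.1]), h.2.symm⟩
      · simp only [Prod.mk.injEq] at h1 h3
        exact absurd (h1.1 ▸ h3.1) hga
      · simp only [Prod.mk.injEq] at h1 h3
        exact absurd (memX (h1.1 ▸ h3)) hgaX
      · simp only [Prod.mk.injEq] at h1 h3
        exact absurd h3.1 (haZ x h2)
      · simp only at h1 h3
        obtain rfl : x = q := h1
        refine ⟨g.symm q', Or.inr ⟨h2, ?_⟩, g.apply_symm_apply q'⟩
        simpa using h3)) (S := insert a p.dom) (p.finite_dom.insert _)
  have hba : b ≠ a := fun h => hbS (Or.inl h)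
  have hbL : b ∉ p.dom := fun h => hbS (Or.inr h)
  let c : M → ℕ × ℤ := fun y => if y = a then (N, 0) else if y = b then (N, 1) else p.label y
  have hca : c a = (N, 0) := if_pos rfl
  have hcb : c b = (N, 1) := by simp only [c, if_neg hba, if_true]
  have hcL : ∀ y ∈ p.dom, c y = p.label y := by
    intro y hy
    have e1 : y ≠ a := fun h => haL (h ▸ hy)
    have e2 : y ≠ b := fun h => hbL (h ▸ hy)
    simp only [c, if_neg e1, if_neg e2]
  refine ⟨⟨insert (g b, g u) (insert (a, u) p.map), c, insert a (insert b p.dom),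
    (p.finite_map.insert _).insert _, (p.finite_dom.insert _).insert _,
    (hpb'.map_left g.symm).mono ?_, ?_⟩, ⟨fun q hq => Or.inr (Or.inr hq),
    fun q hq => Or.inr (Or.inr hq), hcL⟩, a, b,
    ⟨u, Or.inr (Or.inl rfl), Or.inl rfl⟩, congrArg Prod.fst hca, ?_⟩
  · rintro q (rfl | hq)
    · exact Or.inl (by simp)
    · refine Or.inr ?_
      change (g (g.symm q.1), q.2) ∈ insert (a, u) p.map
      rwa [g.apply_symm_apply]
  · rintro y b' ⟨u₁, h4, h5⟩
    simp only [Set.mem_insert_iff, Prod.mk.injEq] at h4 h5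
    rcases h4 with ⟨-, rfl⟩ | ⟨rfl, rfl⟩ | h4 <;> rcases h5 with ⟨h5, h6⟩ | ⟨h5, h6⟩ | h5
    · exact absurd (g.injective h6) hgu
    · exact absurd h6 (apply_apply_ne hδ (hA δ) hgu)
    · exact absurd (memR h5) hgguR
    · obtain rfl := g.injective h5
      rw [hca, hcb]
      exact ⟨Or.inl rfl, Or.inr (Or.inl rfl), rfl⟩
    · exact absurd h6 hgu
    · exact absurd (memR h5) hguR
    · exact absurd (g.injective h6 ▸ memR h4) huR
    · exact absurd h6 (huR' _ (memR h4))
    · obtain ⟨h7, h8, h9⟩ := p.edge y b' ⟨u₁, h4, h5⟩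
      rw [hcL y h7, hcL b' h8]
      exact ⟨Or.inr (Or.inr h7), Or.inr (Or.inr h8), h9⟩
  · rw [Set.insert_comm]
    exact hpb

/-- Every nontrivial automorphism has a rich commutator. -/
theorem exists_isRich (hM : IsFraisseLimit (finiteHypertournaments.{v, w} n) M)
    {δ : I} (hδ : n δ = 2) {g : M ≃[lang n] M} (hg : ∃ c, g c ≠ c) :
    ∃ h : M ≃[lang n] M, IsRich (g⁻¹ * h⁻¹ * g * h) := by
  classical
  have := Encodable.ofCountable M
  let D : M ⊕ M ⊕ Finset M × M × M × ℕ → Order.Cofinal (Approx g)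
    | .inl x => ⟨{p | ∃ u, (x, u) ∈ p.map}, fun p => by
        obtain ⟨q, h, h'⟩ := p.exists_mem_domain hM hδ hg x
        exact ⟨q, h', h⟩⟩
    | .inr (.inl u) => ⟨{p | ∃ x, (x, u) ∈ p.map}, fun p => by
        obtain ⟨q, h, h'⟩ := p.exists_mem_range hM hδ hg u
        exact ⟨q, h', h⟩⟩
    | .inr (.inr (Z, a₀, b₀, N)) => ⟨{p | a₀ ≠ b₀ → a₀ ∉ Z → b₀ ∉ Z → IsPartialIso n
        (insert (a₀, b₀) {q : M × M | q.1 ∈ Z ∧ q.2 ∈ Z ∧ q ∈ commEdges g p.map}) →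
        ∃ a b, (a, b) ∈ commEdges g p.map ∧ (p.label a).1 = N ∧
          IsPartialIso n (insert (a, a₀) (insert (b, b₀) {q : M × M | q.1 = q.2 ∧ q.1 ∈ Z}))},
        fun p => by
        by_cases H : a₀ ≠ b₀ ∧ a₀ ∉ Z ∧ b₀ ∉ Z ∧ IsPartialIso n
          (insert (a₀, b₀) {q : M × M | q.1 ∈ Z ∧ q.2 ∈ Z ∧ q ∈ commEdges g p.map})
        · obtain ⟨h1, h2, h3, h4⟩ := H
          obtain ⟨q, h, h'⟩ := p.exists_edge hM hδ hg Z.finite_toSet h1 h2 h3 h4 N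
          exact ⟨q, fun _ _ _ _ => h', h⟩
        · exact ⟨p, fun h1 h2 h3 h4 => absurd ⟨h1, h2, h3, h4⟩ H, le_rfl⟩⟩
  let p₀ : Approx g := ⟨∅, fun _ => 0, ∅, Set.finite_empty, Set.finite_empty,
    isPartialIso_empty, by rintro x b ⟨u, h, -⟩; exact h.elim⟩
  let P := Order.sequenceOfCofinals p₀ D
  have hP : Monotone P := Order.sequenceOfCofinals.monotone p₀ D
  have hD : ∀ d, ∃ j, P j ∈ D d := fun d =>
    ⟨_, Order.sequenceOfCofinals.encode_mem p₀ D d⟩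
  obtain ⟨h, hh⟩ := exists_equiv_of_monotone (s := fun j => (P j).map)
    (fun i j hij => (hP hij).1) (fun j => (P j).isPartialIso)
    (fun x => hD (.inl x)) (fun u => hD (.inr (.inl u)))
  refine ⟨h, ?_⟩
  set F := g⁻¹ * h⁻¹ * g * h with hF
  have hFiff : ∀ x b, F x = b ↔ ∃ j, (x, b) ∈ commEdges g (P j).map := by
    intro x b
    have h1 : F x = g.symm (h.symm (g (h x))) := rfl
    constructor
    · rintro rfl
      obtain ⟨i, hi⟩ := (hh x (h x)).1 rfl
      obtain ⟨j, hj⟩ := (hh (g (F x)) (g (h x))).1 (by simp [h1])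
      exact ⟨max i j, h x, (hP (le_max_left _ _)).1 hi, (hP (le_max_right _ _)).1 hj⟩
    · rintro ⟨j, u, h2, h3⟩
      have h4 := (hh _ _).2 ⟨j, h2⟩
      have h5 := (hh _ _).2 ⟨j, h3⟩
      rw [h1, h4, ← h5]
      simp
  have hlab : ∀ x, ∃ j, x ∈ (P j).dom := fun x => by
    obtain ⟨j, hj⟩ := (hFiff x _).1 rfl
    exact ⟨j, ((P j).edge _ _ hj).1⟩
  choose J hJ using hlab
  let c : M → ℕ × ℤ := fun x => (P (J x)).label x
  have hc : ∀ {x j}, x ∈ (P j).dom → (P j).label x = c x := by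
    intro x j hx
    rcases le_total j (J x) with h | h
    · exact ((hP h).2.2 x hx).symm
    · exact (hP h).2.2 x (hJ x)
  have hcF : ∀ x, c (F x) = nextLabel (c x) := by
    intro x
    obtain ⟨j, hj⟩ := (hFiff x _).1 rfl
    obtain ⟨h1, h2, h3⟩ := (P j).edge _ _ hj
    rw [← hc h1, ← hc h2, h3]
  have hcz := zpow_apply_label hcF
  constructor
  · intro m hm x h1
    have h2 := hcz m x
    rw [zpow_natCast, h1] at h2
    have := congrArg Prod.snd h2
    simp only at this
    omega
  -- an automorphism `α` extending `k` turns the requirement for `k` into one for the identity on the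
  -- range of `k`; the name `N` is not used on the orbits that meet `S`
  · intro k hkf hk x y hxy hx hy hpi S hS
    obtain ⟨α, hα⟩ := exists_equiv_of_isPartialIso hM hkf hk
    set Z : Finset M := (hkf.image Prod.snd).toFinset with hZ
    have memZ : ∀ {z}, z ∈ Z ↔ (α.symm z, z) ∈ k := by
      intro z
      rw [hZ, Set.Finite.mem_toFinset]
      constructor
      · rintro ⟨q, hq, rfl⟩
        have := hα _ _ hq
        rwa [← this, α.symm_apply_apply, this]
      · exact fun h => ⟨_, h, rfl⟩
    obtain ⟨N, hN⟩ : ∃ N, ∀ s ∈ S, (c s).1 < N := by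
      obtain ⟨b, hb⟩ := (hS.image fun s => (c s).1).bddAbove
      exact ⟨b + 1, fun s hs => Nat.lt_succ_of_le (hb ⟨s, hs, rfl⟩)⟩
    obtain ⟨j, hj⟩ := hD (.inr (.inr (Z, α x, α y, N)))
    obtain ⟨a, b, hab, hlab, hpi'⟩ := hj (fun h => hxy (α.injective h))
      (fun h => hx (α x) (by simpa using memZ.1 h)) (fun h => hy (α y) (by simpa using memZ.1 h))
      ((hpi.conj α.symm).mono (by
        rintro ⟨q, q'⟩ (h1 | ⟨h1, h2, h3⟩)
        · simp only [Prod.mk.injEq] at h1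
          refine Or.inl ?_
          simp [h1.1, h1.2]
        · refine Or.inr ⟨q, memZ.1 h1, ?_⟩
          rw [(hFiff q q').2 ⟨j, h3⟩]
          exact memZ.1 h2))
    have hFa : F a = b := (hFiff a b).2 ⟨j, hab⟩
    have hca : (c a).1 = N := by rw [← hc ((P j).edge _ _ hab).1, hlab]
    refine ⟨a, fun m h1 => ?_, (hpi'.map_right α.symm).inv.mono ?_⟩
    · have := hN _ h1
      rw [hcz, hca] at this
      exact lt_irrefl _ this
    · rintro q (rfl | rfl | hq)
      · exact ⟨α x, Or.inl rfl, α.symm_apply_apply x⟩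
      · exact ⟨α y, Or.inr (Or.inl (by rw [hFa])), α.symm_apply_apply y⟩
      · have h1 : α q.1 = q.2 := hα _ _ hq
        refine ⟨q.2, Or.inr (Or.inr ⟨rfl, memZ.2 ?_⟩), ?_⟩
        · rw [← h1, α.symm_apply_apply, h1]
          exact hq
        · rw [← h1, α.symm_apply_apply]

end Rich

/-! ### Orbits of rich automorphisms -/

section Orbits

variable {M : Type w} [(lang n).Structure M]

theorem inv_apply_self (F : M ≃[lang n] M) (x : M) : F⁻¹ (F x) = x := F.symm_apply_apply x

theorem apply_inv_self (F : M ≃[lang n] M) (x : M) : F (F⁻¹ x) = x := F.apply_symm_apply x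

theorem zpow_add_apply (F : M ≃[lang n] M) (a b : ℤ) (x : M) :
    (F ^ (a + b)) x = (F ^ a) ((F ^ b) x) := by
  rw [zpow_add]
  rfl

theorem zpow_add_one_apply (F : M ≃[lang n] M) (a : ℤ) (x : M) :
    (F ^ (a + 1)) x = F ((F ^ a) x) := by
  rw [add_comm, zpow_one_add]
  rfl

theorem zpow_add_one_apply' (F : M ≃[lang n] M) (a : ℤ) (x : M) :
    (F ^ (a + 1)) x = (F ^ a) (F x) := by
  rw [zpow_add_one]
  rfl

theorem zpow_zero_apply (F : M ≃[lang n] M) (x : M) : (F ^ (0 : ℤ)) x = x := by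
  rw [zpow_zero]
  rfl

theorem mem_edges_inv {F : M ≃[lang n] M} {k : Set (M × M)} {a b : M} :
    (a, b) ∈ edges F⁻¹ k ↔ (b, a) ∈ edges F k := by
  constructor
  · rintro ⟨u, h1, h2⟩
    exact ⟨F⁻¹ u, h2, by simpa only [apply_inv_self] using h1⟩
  · rintro ⟨u, h1, h2⟩
    exact ⟨F u, h2, by simpa only [inv_apply_self] using h1⟩

theorem IsPartialIso.edges {k : Set (M × M)} (hk : IsPartialIso n k) (F : M ≃[lang n] M) :
    IsPartialIso n (edges F k) :=
  ((hk.map_right F).comp hk.inv).mono fun _ ⟨u, h1, h2⟩ => ⟨F u, ⟨u, h1, rfl⟩, h2⟩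

theorem IsRich.eq_of_zpow_eq {F : M ≃[lang n] M} (hF : IsRich F) {a b : ℤ} {x : M}
    (h : (F ^ a) x = (F ^ b) x) : a = b := by
  have key : ∀ a b : ℤ, a < b → (F ^ a) x ≠ (F ^ b) x := by
    intro a b hab h
    obtain ⟨m, hm⟩ := Int.eq_ofNat_of_zero_le (sub_nonneg.2 hab.le)
    have h1 : (F ^ b) x = (F ^ m) ((F ^ a) x) := by
      rw [← zpow_natCast, ← zpow_add_apply, ← hm, sub_add_cancel]
    exact hF.pow_ne m (by omega) _ (h1.symm.trans h.symm)
  rcases lt_trichotomy a b with hab | hab | hab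
  · exact absurd h (key _ _ hab)
  · exact hab
  · exact absurd h.symm (key _ _ hab)

theorem IsRich.apply_ne {F : M ≃[lang n] M} (hF : IsRich F) (x : M) : F x ≠ x := by
  have := hF.pow_ne 1 one_pos x
  rwa [pow_one] at this

theorem IsRich.inv {F : M ≃[lang n] M} (hF : IsRich F) : IsRich F⁻¹ := by
  constructor
  · intro m hm x h
    have h1 : (F ^ (-(m : ℤ))) x = (F ^ (0 : ℤ)) x := by
      rw [zpow_zero_apply, zpow_neg, zpow_natCast, ← inv_pow]
      exact h
    have := hF.eq_of_zpow_eq h1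
    omega
  · intro k hkf hk x y hxy hx hy hpi S hS
    obtain ⟨u, hu, hpi'⟩ := hF.exists_edge k hkf hk y x hxy.symm hy hx (hpi.inv.mono (by
      rintro ⟨a, b⟩ (h | h)
      · simp only [Prod.mk.injEq] at h
        exact Or.inl (by simp [h.1, h.2])
      · exact Or.inr (mem_edges_inv.2 h))) S hS
    refine ⟨F u, fun m => ?_, ?_⟩
    · rw [inv_zpow', ← zpow_add_one_apply']
      exact hu _
    · rw [inv_apply_self, Set.insert_comm]
      exact hpi'

/-- A set that meets every orbit of `F` in an interval. -/
def IsConvex (F : M ≃[lang n] M) (R : Set M) : Prop :=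
  ∀ (z : M) (a b : ℤ), 0 ≤ a → b ≤ 0 → (F ^ a) z ∈ R → (F ^ b) z ∈ R → z ∈ R

theorem IsConvex.inv {F : M ≃[lang n] M} {R : Set M} (hR : IsConvex F R) : IsConvex F⁻¹ R := by
  intro z a b ha hb h1 h2
  rw [inv_zpow'] at h1 h2
  exact hR z (-b) (-a) (by omega) (by omega) h2 h1

theorem IsConvex.mem_of_apply {F : M ≃[lang n] M} {R : Set M} (hR : IsConvex F R) {z : M}
    (h1 : F z ∈ R) (h2 : F⁻¹ z ∈ R) : z ∈ R :=
  hR z 1 (-1) (by omega) (by omega) (by rwa [zpow_one]) (by rwa [zpow_neg_one])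

theorem IsConvex.insert_of_orbit {F : M ≃[lang n] M} (hF : IsRich F) {R : Set M}
    (hR : IsConvex F R) {u : M} (hu : ∀ m : ℤ, (F ^ m) u ∉ R) : IsConvex F (insert u R) := by
  have orbit : ∀ (z : M) (a b : ℤ), (F ^ a) z = u → (F ^ b) z ∉ R := by
    rintro z a b rfl h
    refine hu (b - a) ?_
    rwa [← zpow_add_apply, sub_add_cancel]
  rintro z a b ha hb (h1 | h1) (h2 | h2)
  · have := hF.eq_of_zpow_eq (h1.trans h2.symm)
    obtain rfl : a = 0 := by omega
    exact Or.inl (by rw [← h1, zpow_zero_apply])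
  · exact absurd h2 (orbit z a b h1)
  · exact absurd h1 (orbit z b a h2)
  · exact Or.inr (hR z a b ha hb h1 h2)

theorem IsConvex.insert_of_apply_mem {F : M ≃[lang n] M} (hF : IsRich F) {R : Set M}
    (hR : IsConvex F R) {u : M} (hu : F u ∈ R) : IsConvex F (insert u R) := by
  rintro z a b ha hb (h1 | h1) (h2 | h2)
  · have := hF.eq_of_zpow_eq (h1.trans h2.symm)
    obtain rfl : a = 0 := by omega
    exact Or.inl (by rw [← h1, zpow_zero_apply])
  · refine Or.inr (hR z (a + 1) b (by omega) hb ?_ h2)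
    rwa [zpow_add_one_apply, h1]
  · rcases hb.lt_or_eq with hb | rfl
    · refine Or.inr (hR z a (b + 1) ha (by omega) h1 ?_)
      rwa [zpow_add_one_apply, h2]
    · exact Or.inl (by rw [← h2, zpow_zero_apply])
  · exact Or.inr (hR z a b ha hb h1 h2)

theorem IsConvex.insert_of_inv_apply_mem {F : M ≃[lang n] M} (hF : IsRich F) {R : Set M}
    (hR : IsConvex F R) {u : M} (hu : F⁻¹ u ∈ R) : IsConvex F (insert u R) := by
  have := (hR.inv.insert_of_apply_mem hF.inv hu).inv
  rwa [inv_inv] at this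

/-- The edges created by adding `x ↦ u` join `x` to the preimages of the neighbours of `u`. -/
theorem mem_edges_insert {F : M ≃[lang n] M} {k : Set (M × M)} {x u : M} (hu : F u ≠ u)
    {a b : M} : (a, b) ∈ edges F (insert (x, u) k) ↔
      (a, b) ∈ edges F k ∨ (a = x ∧ (b, F u) ∈ k) ∨ (b = x ∧ (a, F⁻¹ u) ∈ k) := by
  constructor
  · rintro ⟨v, h1, h2⟩
    simp only [Set.mem_insert_iff, Prod.mk.injEq] at h1 h2
    rcases h1 with ⟨rfl, rfl⟩ | h1 <;> rcases h2 with ⟨rfl, h2⟩ | h2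
    · exact absurd h2 hu
    · exact Or.inr (Or.inl ⟨rfl, h2⟩)
    · refine Or.inr (Or.inr ⟨rfl, ?_⟩)
      rwa [← h2, inv_apply_self]
    · exact Or.inl ⟨v, h1, h2⟩
  · rintro (⟨v, h1, h2⟩ | ⟨rfl, h⟩ | ⟨rfl, h⟩)
    · exact ⟨v, Or.inr h1, Or.inr h2⟩
    · exact ⟨u, Or.inl rfl, Or.inr h⟩
    · exact ⟨F⁻¹ u, Or.inr h, Or.inl (by rw [apply_inv_self])⟩

end Orbits

/-! ### Products of two conjugates of a rich automorphism -/

section Factor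

variable {M : Type w} [(lang n).Structure M]

/-- A finite partial isomorphism whose range meets every `F`-orbit in an interval. Hence a point next
to the range on an orbit has only one neighbour in the range, and adding it creates one edge. -/
structure IsAdmissible (F : M ≃[lang n] M) (k : Set (M × M)) : Prop where
  finite : k.Finite
  isPartialIso : IsPartialIso n k
  convex : IsConvex F (Prod.snd '' k)

theorem IsAdmissible.inv {F : M ≃[lang n] M} {k : Set (M × M)} (h : IsAdmissible F k) :
    IsAdmissible F⁻¹ k :=
  ⟨h.finite, h.isPartialIso, h.convex.inv⟩

/-- Approximations `k₁`, `k₂` to automorphisms `α₁`, `α₂` with `h = (α₂⁻¹ F α₂) (α₁⁻¹ F α₁)`: the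
path `x ↦ y ↦ h x` through the determined parts of the two conjugates is determined either
completely or not at all, and completely if both of its ends `x` and `h x` have been reached. -/
structure IsFactorization (F h : M ≃[lang n] M) (k₁ k₂ : Set (M × M)) : Prop where
  left : IsAdmissible F k₁
  right : IsAdmissible F k₂
  edge_iff : ∀ x y, (x, y) ∈ edges F k₁ ↔ (y, h x) ∈ edges F k₂
  exists_edge : ∀ x u v, (x, u) ∈ k₁ → (h x, v) ∈ k₂ → ∃ y, (x, y) ∈ edges F k₁

/-- Inverting `h = (α₂⁻¹ F α₂) (α₁⁻¹ F α₁)` exchanges the roles of `k₁` and `k₂`. -/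
theorem IsFactorization.symm {F h : M ≃[lang n] M} {k₁ k₂ : Set (M × M)}
    (H : IsFactorization F h k₁ k₂) : IsFactorization F⁻¹ h⁻¹ k₂ k₁ := by
  refine ⟨H.right.inv, H.left.inv, fun x y => ?_, fun x u v hx hv => ?_⟩
  · rw [mem_edges_inv, mem_edges_inv, H.edge_iff, apply_inv_self]
  · obtain ⟨y, hy⟩ := H.exists_edge _ v u hv (by rwa [apply_inv_self])
    rw [H.edge_iff, apply_inv_self] at hy
    exact ⟨y, mem_edges_inv.2 hy⟩

theorem IsFactorization.of_symm {F h : M ≃[lang n] M} {k₁ k₂ : Set (M × M)}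
    (H : IsFactorization F⁻¹ h⁻¹ k₂ k₁) : IsFactorization F h k₁ k₂ := by
  have := H.symm
  rwa [inv_inv, inv_inv] at this

theorem image_snd_insert {x u : M} {k : Set (M × M)} :
    Prod.snd '' (insert (x, u) k) = insert u (Prod.snd '' k) :=
  Set.image_insert_eq

/-- Richness adds the edge `x ↦ y`, on an orbit that does not meet the range, and no other edge. -/
theorem IsAdmissible.exists_insert_edge {F : M ≃[lang n] M} (hF : IsRich F) {k : Set (M × M)}
    (hk : IsAdmissible F k) {x y : M} (hxy : x ≠ y) (hx : ∀ u, (x, u) ∉ k) (hy : ∀ u, (y, u) ∉ k)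
    (hpi : IsPartialIso n (insert (x, y) (edges F k))) :
    ∃ u, (∀ m : ℤ, (F ^ m) u ∉ Prod.snd '' k) ∧
      IsAdmissible F (insert (x, u) (insert (y, F u) k)) ∧
      edges F (insert (x, u) (insert (y, F u) k)) = insert (x, y) (edges F k) := by
  obtain ⟨u, hu, hpi'⟩ := hF.exists_edge k hk.finite hk.isPartialIso x y hxy hx hy hpi
    (Prod.snd '' k) (hk.finite.image _)
  have hu1 : ∀ z, (z, F (F u)) ∉ k := fun z h => hu (1 + 1) ⟨_, h, by
    rw [zpow_add_one_apply, zpow_one]⟩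
  have hu2 : ∀ z, (z, F u) ∉ k := fun z h => hu 1 ⟨_, h, by rw [zpow_one]⟩
  have hu3 : ∀ z, (z, u) ∉ k := fun z h => hu 0 ⟨_, h, by rw [zpow_zero_apply]⟩
  have hu4 : ∀ z, (z, F⁻¹ u) ∉ k := fun z h => hu (-1) ⟨_, h, by rw [zpow_neg_one]⟩
  have hu5 : F⁻¹ u ≠ F u := fun h => hF.pow_ne 2 two_pos u (by
    rw [pow_two]
    change F (F u) = u
    rw [← h, apply_inv_self])
  refine ⟨u, hu, ⟨(hk.finite.insert _).insert _, hpi', ?_⟩, ?_⟩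
  · rw [image_snd_insert, image_snd_insert]
    refine IsConvex.insert_of_apply_mem hF (hk.convex.insert_of_orbit hF fun m => ?_)
      (Set.mem_insert _ _)
    rw [← zpow_add_one_apply']
    exact hu _
  · ext ⟨a, b⟩
    rw [mem_edges_insert (hF.apply_ne _), mem_edges_insert (hF.apply_ne _), inv_apply_self]
    simp only [Set.mem_insert_iff, Prod.mk.injEq, hu1, hu2, hu3, hu4, and_false, or_false,
      and_true, hu5]
    tauto

variable [Countable M]

/-- A point can be added to the domain without new edges. -/
theorem IsAdmissible.exists_insert (hM : IsFraisseLimit (finiteHypertournaments.{v, w} n) M)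
    {δ : I} (hδ : n δ = 2) {F : M ≃[lang n] M} (hF : IsRich F) {k : Set (M × M)}
    (hk : IsAdmissible F k) {x : M} (hx : ∀ u, (x, u) ∉ k) :
    ∃ u, IsAdmissible F (insert (x, u) k) ∧ edges F (insert (x, u) k) = edges F k := by
  -- a second point `y` such that `x ↦ y` is a possible edge
  obtain ⟨y, hyS, -, hpi⟩ := Hypertournament.exists_insert hM hδ (g := F) ⟨x, hF.apply_ne x⟩
    (k := {q : M × M | (q.2, q.1) ∈ edges F k}) (by
      refine ((hk.finite.image Prod.fst).prod (hk.finite.image Prod.fst)).subset ?_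
      rintro q ⟨u, h1, h2⟩
      exact ⟨⟨_, h2, rfl⟩, ⟨_, h1, rfl⟩⟩) (hk.isPartialIso.edges F).inv (u := x)
    (fun z ⟨u, h, _⟩ => hx u h) (S := insert x (Prod.fst '' k)) ((hk.finite.image _).insert _)
  obtain ⟨u, hu, h1, -⟩ := hk.exists_insert_edge hF (x := x) (y := y)
    (fun h => hyS (Or.inl h.symm)) hx (fun u h => hyS (Or.inr ⟨_, h, rfl⟩)) (hpi.inv.mono (by
      rintro q (rfl | h)
      · exact Or.inl rfl
      · exact Or.inr h))
  refine ⟨u, ⟨hk.finite.insert _, h1.isPartialIso.mono ?_, ?_⟩, ?_⟩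
  · exact Set.insert_subset_insert (Set.subset_insert _ _)
  · rw [image_snd_insert]
    exact hk.convex.insert_of_orbit hF hu
  · ext ⟨a, b⟩
    have hu2 : ∀ z, (z, F u) ∉ k := fun z h => hu 1 ⟨_, h, by rw [zpow_one]⟩
    have hu4 : ∀ z, (z, F⁻¹ u) ∉ k := fun z h => hu (-1) ⟨_, h, by rw [zpow_neg_one]⟩
    simp [mem_edges_insert (hF.apply_ne _), hu2, hu4]

variable {F h : M ≃[lang n] M} {k₁ k₂ : Set (M × M)}

/-- If `h x` is not in the domain of `k₂`, no path through `x` has to be completed, and `x` is sent to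
a fresh orbit. Otherwise the path `x ↦ y ↦ h x` is completed by a fresh point `y`: its image under
`k₂` is forced, and richness supplies the images of `x` and `y` under `k₁`. -/
theorem IsFactorization.exists_mem_domain_left
    (hM : IsFraisseLimit (finiteHypertournaments.{v, w} n) M) {δ : I} (hδ : n δ = 2)
    (hF : IsRich F) (hh : ∃ c, h c ≠ c) (H : IsFactorization F h k₁ k₂) (x : M) :
    ∃ k₁' k₂', IsFactorization F h k₁' k₂' ∧ k₁ ⊆ k₁' ∧ k₂ ⊆ k₂' ∧ ∃ u, (x, u) ∈ k₁' := by
  by_cases hx : ∃ u, (x, u) ∈ k₁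
  · exact ⟨k₁, k₂, H, subset_rfl, subset_rfl, hx⟩
  push Not at hx
  by_cases hhx : ∃ v, (h x, v) ∈ k₂
  · obtain ⟨v, hv⟩ := hhx
    -- the middle `y` of the path `x ↦ y ↦ h x` has to be sent to `F⁻¹ v` by `k₂`
    have hw : ∀ y, (y, F⁻¹ v) ∉ k₂ := by
      intro y hy
      obtain ⟨u, hu, -⟩ := (H.edge_iff x y).2 ⟨F⁻¹ v, hy, by rwa [apply_inv_self]⟩
      exact hx u hu
    have hw' : ∀ y, (y, F⁻¹ (F⁻¹ v)) ∉ k₂ := by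
      intro y hy
      obtain ⟨⟨z, _⟩, hz, rfl⟩ := H.right.convex.mem_of_apply (z := F⁻¹ v)
        ⟨_, hv, (apply_inv_self _ _).symm⟩ ⟨_, hy, rfl⟩
      exact hw _ hz
    have hf1 := H.left.finite.image Prod.fst
    have hf2 := H.right.finite.image Prod.fst
    obtain ⟨y, hyS, hhy, hpi⟩ := exists_insert hM hδ hh H.right.finite H.right.isPartialIso hw
      (S := insert x (insert (h x) (Prod.fst '' k₁ ∪ Prod.fst '' k₂ ∪ h '' (Prod.fst '' k₁) ∪
        h ⁻¹' (Prod.fst '' k₂)))) ((((((hf1.union hf2).union (hf1.image _)).union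
          (hf2.preimage h.injective.injOn))).insert _).insert _)
    have hyx : x ≠ y := fun h => hyS (Or.inl h.symm)
    have hyhx : h x ≠ y := fun h => hyS (Or.inr (Or.inl h.symm))
    have hy1 : ∀ u, (y, u) ∉ k₁ := fun u hu =>
      hyS (Or.inr (Or.inr (Or.inl (Or.inl (Or.inl ⟨_, hu, rfl⟩)))))
    have hy3 : ∀ z u, (z, u) ∈ k₁ → h z ≠ y := fun z u hz he =>
      hyS (Or.inr (Or.inr (Or.inl (Or.inr ⟨z, ⟨_, hz, rfl⟩, he⟩))))
    have hy4 : ∀ u, (h y, u) ∉ k₂ := fun u hu =>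
      hyS (Or.inr (Or.inr (Or.inr ⟨_, hu, rfl⟩)))
    have hedges : edges F (insert (y, F⁻¹ v) k₂) = insert (y, h x) (edges F k₂) := by
      ext ⟨a, b⟩
      have hb : (b, v) ∈ k₂ ↔ b = h x :=
        ⟨fun hb => H.right.isPartialIso.left_unique hb hv, fun hb => hb ▸ hv⟩
      rw [mem_edges_insert (hF.apply_ne _), apply_inv_self, hb]
      simp only [hw', and_false, or_false, Set.mem_insert_iff, Prod.mk.injEq]
      tauto
    have hpi' := hpi.edges F
    rw [hedges] at hpi'
    obtain ⟨u, -, hadm, hedges'⟩ := H.left.exists_insert_edge hF hyx hx hy1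
      ((hpi'.inv.map_left h).mono (by
        rintro ⟨a, b⟩ (hab | hab)
        · simp only [Prod.mk.injEq] at hab
          exact Or.inl (by rw [hab.1, hab.2])
        · exact Or.inr ((H.edge_iff a b).1 hab)))
    refine ⟨_, _, ⟨hadm, ⟨H.right.finite.insert _, hpi, ?_⟩, fun a b => ?_,
      fun a u' v' ha hv' => ?_⟩, fun q hq => Or.inr (Or.inr hq), fun q hq => Or.inr hq,
      u, Or.inl rfl⟩
    · rw [image_snd_insert]
      refine H.right.convex.insert_of_apply_mem hF ?_
      rw [apply_inv_self]
      exact ⟨_, hv, rfl⟩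
    · rw [hedges, hedges']
      simp only [Set.mem_insert_iff, Prod.mk.injEq, h.injective.eq_iff, H.edge_iff]
      tauto
    · rw [hedges']
      simp only [Set.mem_insert_iff, Prod.mk.injEq] at ha hv'
      rcases ha with ⟨rfl, -⟩ | ⟨rfl, -⟩ | ha
      · exact ⟨y, Or.inl rfl⟩
      · rcases hv' with ⟨hv', -⟩ | hv'
        · exact absurd hv' hhy
        · exact absurd hv' (hy4 _)
      · rcases hv' with ⟨hv', -⟩ | hv'
        · exact absurd hv' (hy3 _ _ ha)
        · obtain ⟨b, hb⟩ := H.exists_edge a u' v' ha hv'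
          exact ⟨b, Or.inr hb⟩
  · push Not at hhx
    obtain ⟨u, hadm, hedges⟩ := H.left.exists_insert hM hδ hF hx
    refine ⟨_, k₂, ⟨hadm, H.right, fun a b => ?_, fun a u' v' ha hv' => ?_⟩,
      Set.subset_insert _ _, subset_rfl, u, Set.mem_insert _ _⟩
    · rw [hedges, H.edge_iff]
    · rw [hedges]
      simp only [Set.mem_insert_iff, Prod.mk.injEq] at ha
      rcases ha with ⟨rfl, -⟩ | ha
      · exact absurd hv' (hhx _)
      · exact H.exists_edge a u' v' ha hv'

theorem IsFactorization.exists_mem_domain_right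
    (hM : IsFraisseLimit (finiteHypertournaments.{v, w} n) M) {δ : I} (hδ : n δ = 2)
    (hF : IsRich F) (hh : ∃ c, h c ≠ c) (H : IsFactorization F h k₁ k₂) (x : M) :
    ∃ k₁' k₂', IsFactorization F h k₁' k₂' ∧ k₁ ⊆ k₁' ∧ k₂ ⊆ k₂' ∧ ∃ u, (x, u) ∈ k₂' := by
  have hh' : ∃ c, h⁻¹ c ≠ c := by
    obtain ⟨c, hc⟩ := hh
    exact ⟨h c, fun he => hc (by rw [inv_apply_self] at he; exact he.symm)⟩
  obtain ⟨k₂', k₁', H', h2, h1, hx⟩ := H.symm.exists_mem_domain_left hM hδ hF.inv hh' x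
  exact ⟨k₁', k₂', H'.of_symm, h1, h2, hx⟩

/-- Extending the range of `k₁` backwards along an orbit. The new preimage `x` of `u` starts the path
`x ↦ y ↦ h x`, which determines the value of `k₂` at `h x` too. -/
theorem IsFactorization.exists_mem_range_of_apply_mem
    (hM : IsFraisseLimit (finiteHypertournaments.{v, w} n) M) {δ : I} (hδ : n δ = 2)
    (hF : IsRich F) (hh : ∃ c, h c ≠ c) (H : IsFactorization F h k₁ k₂) {u y : M}
    (hy : (y, F u) ∈ k₁) :
    ∃ k₁' k₂', IsFactorization F h k₁' k₂' ∧ k₁ ⊆ k₁' ∧ k₂ ⊆ k₂' ∧ ∃ x, (x, u) ∈ k₁' := by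
  -- first `y` is put into the domain of `k₂`
  obtain ⟨l₁, l₂, H', h1, h2, w, hw⟩ := H.exists_mem_domain_right hM hδ hF hh y
  replace hy := h1 hy
  by_cases hu : ∃ x, (x, u) ∈ l₁
  · exact ⟨l₁, l₂, H', h1, h2, hu⟩
  push Not at hu
  have hu' : ∀ x, (x, F⁻¹ u) ∉ l₁ := by
    intro x hx
    obtain ⟨⟨z, _⟩, hz, rfl⟩ := H'.left.convex.mem_of_apply (z := u) ⟨_, hy, rfl⟩ ⟨_, hx, rfl⟩
    exact hu _ hz
  have hFw : ∀ z, (z, F w) ∉ l₂ := by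
    intro z hz
    obtain ⟨u₁, hu₁, hu₁'⟩ := (H'.edge_iff (h⁻¹ z) y).2 ⟨w, hw, by rwa [apply_inv_self]⟩
    rw [F.injective (H'.left.isPartialIso.right_unique hu₁' hy)] at hu₁
    exact hu _ hu₁
  have hFFw : ∀ z, (z, F (F w)) ∉ l₂ := by
    intro z hz
    obtain ⟨⟨z', _⟩, hz', rfl⟩ := H'.right.convex.mem_of_apply (z := F w) ⟨_, hz, rfl⟩
      ⟨_, hw, (inv_apply_self F w).symm⟩
    exact hFw _ hz'
  have himg : Function.Injective fun q : M × M => (h q.1, q.2) := fun q q' e =>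
    Prod.ext (h.injective (Prod.mk.inj e).1) (Prod.mk.inj e).2
  -- the types of `x` over the domain of `k₁` and of `h x` over the domain of `k₂` are prescribed;
  -- they agree because the common part consists of completed paths
  obtain ⟨x, -, -, hpi, hpi'⟩ := exists_insert_insert hM hδ hh H'.left.finite
    (k' := {q : M × M | (h q.1, q.2) ∈ l₂}) (H'.right.finite.preimage himg.injOn)
    H'.left.isPartialIso (H'.right.isPartialIso.map_left h) hu (u' := F w) (fun z => hFw _)
    ((((isPartialIso_graph F).comp H'.left.isPartialIso.inv).comp
      (H'.right.isPartialIso.map_right F)).mono (by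
      rintro ⟨a, b⟩ (hab | ⟨x, hx, hx'⟩)
      · simp only [Prod.mk.injEq] at hab
        exact ⟨y, ⟨F u, by rw [hab.1]; rfl, hy⟩, w, hw, hab.2.symm⟩
      · obtain ⟨y', hy'⟩ := H'.exists_edge x a b hx hx'
        obtain ⟨b', h3, h4⟩ := (H'.edge_iff x y').1 hy'
        obtain ⟨a', h5, h6⟩ := hy'
        rw [H'.left.isPartialIso.right_unique h5 hx] at h6
        exact ⟨y', ⟨F a, rfl, h6⟩, b', h3, H'.right.isPartialIso.right_unique h4 hx'⟩))
    (S := ∅) Set.finite_empty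
  have hpi'' : IsPartialIso n (insert (h x, F w) l₂) := (hpi'.map_left h⁻¹).mono (by
    rintro ⟨a, b⟩ (hab | hab)
    · simp only [Prod.mk.injEq] at hab
      exact Or.inl (by rw [hab.1, hab.2, inv_apply_self])
    · refine Or.inr ?_
      change (h (h⁻¹ a), b) ∈ l₂
      rwa [apply_inv_self])
  have hedges₁ : edges F (insert (x, u) l₁) = insert (x, y) (edges F l₁) := by
    ext ⟨a, b⟩
    have hb : (b, F u) ∈ l₁ ↔ b = y :=
      ⟨fun hb => H'.left.isPartialIso.left_unique hb hy, fun hb => hb ▸ hy⟩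
    rw [mem_edges_insert (hF.apply_ne _), hb]
    simp only [hu', and_false, or_false, Set.mem_insert_iff, Prod.mk.injEq]
    tauto
  have hedges₂ : edges F (insert (h x, F w) l₂) = insert (y, h x) (edges F l₂) := by
    ext ⟨a, b⟩
    have ha : (a, w) ∈ l₂ ↔ a = y :=
      ⟨fun ha => H'.right.isPartialIso.left_unique ha hw, fun ha => ha ▸ hw⟩
    rw [mem_edges_insert (hF.apply_ne _), inv_apply_self, ha]
    simp only [hFFw, and_false, false_or, Set.mem_insert_iff, Prod.mk.injEq]
    tauto
  refine ⟨_, _, ⟨⟨H'.left.finite.insert _, hpi, ?_⟩, ⟨H'.right.finite.insert _, hpi'', ?_⟩,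
    fun a b => ?_, fun a u' v' ha hv' => ?_⟩, h1.trans (Set.subset_insert _ _),
    h2.trans (Set.subset_insert _ _), x, Set.mem_insert _ _⟩
  · rw [image_snd_insert]
    exact H'.left.convex.insert_of_apply_mem hF ⟨_, hy, rfl⟩
  · rw [image_snd_insert]
    exact H'.right.convex.insert_of_inv_apply_mem hF ⟨_, hw, (inv_apply_self F w).symm⟩
  · rw [hedges₁, hedges₂]
    simp only [Set.mem_insert_iff, Prod.mk.injEq, h.injective.eq_iff, H'.edge_iff]
    tauto
  · rw [hedges₁]
    simp only [Set.mem_insert_iff, Prod.mk.injEq, h.injective.eq_iff] at ha hv'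
    by_cases hax : a = x
    · exact ⟨y, Or.inl (by rw [hax])⟩
    · obtain ⟨b, hb⟩ := H'.exists_edge a u' v' (ha.resolve_left fun e => hax e.1)
        (hv'.resolve_left fun e => hax e.1)
      exact ⟨b, Or.inr hb⟩

/-- Extending the range of `k₁` forwards along an orbit. The path through the preimage `z` of `F⁻¹ u`
becomes `z ↦ x ↦ h z` with a fresh point `x`, and richness supplies its second half. -/
theorem IsFactorization.exists_mem_range_of_inv_apply_mem
    (hM : IsFraisseLimit (finiteHypertournaments.{v, w} n) M) {δ : I} (hδ : n δ = 2)
    (hF : IsRich F) (hh : ∃ c, h c ≠ c) (H : IsFactorization F h k₁ k₂) {u z : M}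
    (hz : (z, F⁻¹ u) ∈ k₁) :
    ∃ k₁' k₂', IsFactorization F h k₁' k₂' ∧ k₁ ⊆ k₁' ∧ k₂ ⊆ k₂' ∧ ∃ x, (x, u) ∈ k₁' := by
  by_cases hu : ∃ x, (x, u) ∈ k₁
  · exact ⟨k₁, k₂, H, subset_rfl, subset_rfl, hu⟩
  push Not at hu
  have hFu : ∀ x, (x, F u) ∉ k₁ := by
    intro x hx
    obtain ⟨⟨a, b⟩, hab, rfl⟩ := H.left.convex.mem_of_apply (z := u) ⟨_, hx, rfl⟩ ⟨_, hz, rfl⟩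
    exact hu a hab
  have hhz : ∀ v, (h z, v) ∉ k₂ := by
    intro v hv
    obtain ⟨y, u₁, h1, h2⟩ := H.exists_edge z _ v hz hv
    rw [H.left.isPartialIso.right_unique h1 hz, apply_inv_self] at h2
    exact hu _ h2
  have hf1 := H.left.finite.image Prod.fst
  have hf2 := H.right.finite.image Prod.fst
  -- the new point `x` continues the path `z ↦ x ↦ h z`
  obtain ⟨x, hxS, hhx, hpi⟩ := exists_insert hM hδ hh H.left.finite H.left.isPartialIso hu
    (S := insert (h z) (Prod.fst '' k₁ ∪ Prod.fst '' k₂ ∪ h '' (Prod.fst '' k₁) ∪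
      h ⁻¹' (Prod.fst '' k₂))) (((((hf1.union hf2).union (hf1.image _)).union
        (hf2.preimage h.injective.injOn))).insert _)
  have hxz : x ≠ h z := fun h => hxS (Or.inl h)
  have hx1 : ∀ u, (x, u) ∉ k₁ := fun u hu =>
    hxS (Or.inr (Or.inl (Or.inl (Or.inl ⟨_, hu, rfl⟩))))
  have hx2 : ∀ u, (x, u) ∉ k₂ := fun u hu =>
    hxS (Or.inr (Or.inl (Or.inl (Or.inr ⟨_, hu, rfl⟩))))
  have hx3 : ∀ z u, (z, u) ∈ k₁ → h z ≠ x := fun z u hz he =>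
    hxS (Or.inr (Or.inl (Or.inr ⟨z, ⟨_, hz, rfl⟩, he⟩)))
  have hx4 : ∀ u, (h x, u) ∉ k₂ := fun u hu => hxS (Or.inr (Or.inr ⟨_, hu, rfl⟩))
  have hedges : edges F (insert (x, u) k₁) = insert (z, x) (edges F k₁) := by
    ext ⟨a, b⟩
    have ha : (a, F⁻¹ u) ∈ k₁ ↔ a = z :=
      ⟨fun ha => H.left.isPartialIso.left_unique ha hz, fun ha => ha ▸ hz⟩
    rw [mem_edges_insert (hF.apply_ne _), ha]
    simp only [hFu, and_false, false_or, Set.mem_insert_iff, Prod.mk.injEq]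
    tauto
  have hpi' := hpi.edges F
  rw [hedges] at hpi'
  obtain ⟨w, -, hadm, hedges'⟩ := H.right.exists_insert_edge hF hxz hx2 hhz
    ((hpi'.inv.map_right h).mono (by
      rintro ⟨a, b⟩ (hab | hab)
      · simp only [Prod.mk.injEq] at hab
        exact ⟨z, Or.inl (by rw [hab.1]), hab.2.symm⟩
      · refine ⟨h⁻¹ b, Or.inr ((H.edge_iff _ _).2 ?_), apply_inv_self _ _⟩
        rwa [apply_inv_self]))
  refine ⟨_, _, ⟨⟨H.left.finite.insert _, hpi, ?_⟩, hadm, fun a b => ?_,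
    fun a u' v' ha hv' => ?_⟩, fun q hq => Or.inr hq, fun q hq => Or.inr (Or.inr hq),
    x, Or.inl rfl⟩
  · rw [image_snd_insert]
    exact H.left.convex.insert_of_inv_apply_mem hF ⟨_, hz, rfl⟩
  · rw [hedges, hedges']
    simp only [Set.mem_insert_iff, Prod.mk.injEq, h.injective.eq_iff, H.edge_iff]
    tauto
  · rw [hedges]
    simp only [Set.mem_insert_iff, Prod.mk.injEq, h.injective.eq_iff] at ha hv'
    rcases ha with ⟨rfl, -⟩ | ha
    · rcases hv' with ⟨hv', -⟩ | ⟨rfl, -⟩ | hv'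
      · exact absurd hv' hhx
      · exact absurd hz (hx1 _)
      · exact absurd hv' (hx4 _)
    · rcases hv' with ⟨hv', -⟩ | ⟨rfl, -⟩ | hv'
      · exact absurd hv' (hx3 _ _ ha)
      · exact ⟨x, Or.inl rfl⟩
      · obtain ⟨b, hb⟩ := H.exists_edge a u' v' ha hv'
        exact ⟨b, Or.inr hb⟩

/-- If the orbit of `u` does not meet the range of `k₁`, then `u` is given a fresh preimage; otherwise
the range is extended along the orbit until it reaches `u`. -/
theorem IsFactorization.exists_mem_range_left
    (hM : IsFraisseLimit (finiteHypertournaments.{v, w} n) M) {δ : I} (hδ : n δ = 2)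
    (hF : IsRich F) (hh : ∃ c, h c ≠ c) (H : IsFactorization F h k₁ k₂) (u : M) :
    ∃ k₁' k₂', IsFactorization F h k₁' k₂' ∧ k₁ ⊆ k₁' ∧ k₂ ⊆ k₂' ∧ ∃ x, (x, u) ∈ k₁' := by
  by_cases hu : ∃ m : ℤ, (F ^ m) u ∈ Prod.snd '' k₁
  · obtain ⟨m, hm⟩ := hu
    induction m generalizing u with
    | zero =>
      rw [zpow_zero_apply] at hm
      obtain ⟨⟨x, _⟩, hx, rfl⟩ := hm
      exact ⟨k₁, k₂, H, subset_rfl, subset_rfl, x, hx⟩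
    | succ m ih =>
      rw [zpow_add_one_apply'] at hm
      obtain ⟨l₁, l₂, H', h1, h2, y, hy⟩ := ih (F u) hm
      obtain ⟨m₁, m₂, H'', h3, h4, hx⟩ := H'.exists_mem_range_of_apply_mem hM hδ hF hh hy
      exact ⟨m₁, m₂, H'', h1.trans h3, h2.trans h4, hx⟩
    | pred m ih =>
      have hm' : (F ^ (-(m : ℤ))) (F⁻¹ u) ∈ Prod.snd '' k₁ := by
        have := zpow_add_one_apply' F (-m - 1) (F⁻¹ u)
        rw [sub_add_cancel, apply_inv_self] at this
        rwa [this]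
      obtain ⟨l₁, l₂, H', h1, h2, y, hy⟩ := ih (F⁻¹ u) hm'
      obtain ⟨m₁, m₂, H'', h3, h4, hx⟩ := H'.exists_mem_range_of_inv_apply_mem hM hδ hF hh hy
      exact ⟨m₁, m₂, H'', h1.trans h3, h2.trans h4, hx⟩
  · push Not at hu
    have hu1 : ∀ x, (x, u) ∉ k₁ := fun x hx => hu 0 ⟨_, hx, (zpow_zero_apply _ _).symm⟩
    have hu2 : ∀ z, (z, F u) ∉ k₁ := fun z h => hu 1 ⟨_, h, by rw [zpow_one]⟩
    have hu4 : ∀ z, (z, F⁻¹ u) ∉ k₁ := fun z h => hu (-1) ⟨_, h, by rw [zpow_neg_one]⟩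
    obtain ⟨x, hxS, -, hpi⟩ := exists_insert hM hδ hh H.left.finite H.left.isPartialIso hu1
      ((H.right.finite.image Prod.fst).preimage h.injective.injOn)
    have hedges : edges F (insert (x, u) k₁) = edges F k₁ := by
      ext ⟨a, b⟩
      simp [mem_edges_insert (hF.apply_ne _), hu2, hu4]
    refine ⟨_, k₂, ⟨⟨H.left.finite.insert _, hpi, ?_⟩, H.right, fun a b => ?_,
      fun a u' v' ha hv' => ?_⟩, Set.subset_insert _ _, subset_rfl, x, Set.mem_insert _ _⟩
    · rw [image_snd_insert]
      exact H.left.convex.insert_of_orbit hF hu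
    · rw [hedges, H.edge_iff]
    · rw [hedges]
      simp only [Set.mem_insert_iff, Prod.mk.injEq] at ha
      rcases ha with ⟨rfl, -⟩ | ha
      · exact absurd ⟨_, hv', rfl⟩ hxS
      · exact H.exists_edge a u' v' ha hv'

theorem IsFactorization.exists_mem_range_right
    (hM : IsFraisseLimit (finiteHypertournaments.{v, w} n) M) {δ : I} (hδ : n δ = 2)
    (hF : IsRich F) (hh : ∃ c, h c ≠ c) (H : IsFactorization F h k₁ k₂) (u : M) :
    ∃ k₁' k₂', IsFactorization F h k₁' k₂' ∧ k₁ ⊆ k₁' ∧ k₂ ⊆ k₂' ∧ ∃ x, (x, u) ∈ k₂' := by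
  have hh' : ∃ c, h⁻¹ c ≠ c := by
    obtain ⟨c, hc⟩ := hh
    exact ⟨h c, fun he => hc (by rw [inv_apply_self] at he; exact he.symm)⟩
  obtain ⟨k₂', k₁', H', h2, h1, hx⟩ := H.symm.exists_mem_range_left hM hδ hF.inv hh' u
  exact ⟨k₁', k₂', H'.of_symm, h1, h2, hx⟩

/-- Every nontrivial automorphism is the product of two conjugates of any rich one. -/
theorem IsRich.exists_eq_mul_conj
    (hM : IsFraisseLimit (finiteHypertournaments.{v, w} n) M) {δ : I} (hδ : n δ = 2)
    (hF : IsRich F) (hh : ∃ c, h c ≠ c) :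
    ∃ α₁ α₂ : M ≃[lang n] M, h = (α₂⁻¹ * F * α₂) * (α₁⁻¹ * F * α₁) := by
  have := Encodable.ofCountable M
  let P := {k : Set (M × M) × Set (M × M) // IsFactorization F h k.1 k.2}
  let D : (M ⊕ M) ⊕ (M ⊕ M) → Order.Cofinal P
    | .inl (.inl x) => ⟨{k | ∃ u, (x, u) ∈ k.1.1}, fun k => by
        obtain ⟨l₁, l₂, H, h1, h2, h3⟩ := k.2.exists_mem_domain_left hM hδ hF hh x
        exact ⟨⟨(l₁, l₂), H⟩, h3, ⟨h1, h2⟩⟩⟩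
    | .inl (.inr u) => ⟨{k | ∃ x, (x, u) ∈ k.1.1}, fun k => by
        obtain ⟨l₁, l₂, H, h1, h2, h3⟩ := k.2.exists_mem_range_left hM hδ hF hh u
        exact ⟨⟨(l₁, l₂), H⟩, h3, ⟨h1, h2⟩⟩⟩
    | .inr (.inl x) => ⟨{k | ∃ u, (x, u) ∈ k.1.2}, fun k => by
        obtain ⟨l₁, l₂, H, h1, h2, h3⟩ := k.2.exists_mem_domain_right hM hδ hF hh x
        exact ⟨⟨(l₁, l₂), H⟩, h3, ⟨h1, h2⟩⟩⟩
    | .inr (.inr u) => ⟨{k | ∃ x, (x, u) ∈ k.1.2}, fun k => by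
        obtain ⟨l₁, l₂, H, h1, h2, h3⟩ := k.2.exists_mem_range_right hM hδ hF hh u
        exact ⟨⟨(l₁, l₂), H⟩, h3, ⟨h1, h2⟩⟩⟩
  have hadm : IsAdmissible F (∅ : Set (M × M)) :=
    ⟨Set.finite_empty, isPartialIso_empty, by rintro z a b - - ⟨q, hq, -⟩; exact hq.elim⟩
  let p₀ : P := ⟨(∅, ∅), hadm, hadm, fun x y =>
    iff_of_false (by rintro ⟨u, hu, -⟩; exact hu) (by rintro ⟨u, hu, -⟩; exact hu),
    fun x u v hx => hx.elim⟩
  let Q := Order.sequenceOfCofinals p₀ D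
  have hQ : Monotone Q := Order.sequenceOfCofinals.monotone p₀ D
  have hD : ∀ d, ∃ j, Q j ∈ D d := fun d =>
    ⟨_, Order.sequenceOfCofinals.encode_mem p₀ D d⟩
  obtain ⟨α₁, h1⟩ := exists_equiv_of_monotone (s := fun j => (Q j).1.1)
    (fun i j hij => (hQ hij).1) (fun j => (Q j).2.left.isPartialIso)
    (fun x => hD (.inl (.inl x))) (fun u => hD (.inl (.inr u)))
  obtain ⟨α₂, h2⟩ := exists_equiv_of_monotone (s := fun j => (Q j).1.2)
    (fun i j hij => (hQ hij).2) (fun j => (Q j).2.right.isPartialIso)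
    (fun x => hD (.inr (.inl x))) (fun u => hD (.inr (.inr u)))
  refine ⟨α₁, α₂, ?_⟩
  ext x
  set y := α₁⁻¹ (F (α₁ x)) with hy
  obtain ⟨i, hi⟩ := (h1 x _).1 rfl
  obtain ⟨j, hj⟩ := (h1 y (F (α₁ x))).1 (apply_inv_self _ _)
  obtain ⟨w, hw, hw'⟩ := ((Q (max i j)).2.edge_iff x y).1
    ⟨_, (hQ (le_max_left i j)).1 hi, (hQ (le_max_right i j)).1 hj⟩
  have e1 := (h2 _ _).2 ⟨_, hw⟩
  have e2 := (h2 _ _).2 ⟨_, hw'⟩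
  change h x = α₂⁻¹ (F (α₂ y))
  rw [e1, ← e2, inv_apply_self]

end Factor

/-! ### Simplicity -/

theorem nonempty_of_isFraisseLimit {M : Type w} [(lang n).Structure M] [Countable M]
    (hM : IsFraisseLimit (finiteHypertournaments.{v, w} n) M) (hn : ∀ i, 2 ≤ n i) :
    Nonempty M := by
  -- the hypertournament with one point embeds into the limit
  let T : (lang n).Structure PUnit.{w + 1} :=
    { funMap := fun f => isEmptyElim f, RelMap := fun _ _ => False }
  have hT : (⟨PUnit.{w + 1}, T⟩ : Bundled.{w} (lang n).Structure) ∈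
      finiteHypertournaments.{v, w} n := by
    refine ⟨inferInstanceAs (Finite PUnit), fun i => ⟨fun v hv => False.elim hv, fun S hS => ?_⟩⟩
    have h1 : S.card ≤ 1 := Finset.card_le_one.2 fun a _ b _ => Subsingleton.elim (α := PUnit) a b
    have h2 := hn i
    omega
  rw [← hM.age] at hT
  obtain ⟨-, ⟨e⟩⟩ := hT
  exact ⟨e PUnit.unit⟩

theorem isSimpleGroup_equiv {M : Type w} [(lang n).Structure M] [Countable M]
    (hM : IsFraisseLimit (finiteHypertournaments.{v, w} n) M) {δ : I} (hδ : n δ = 2)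
    (hn : ∀ i, 2 ≤ n i) : IsSimpleGroup (M ≃[lang n] M) := by
  have hmove : ∀ g : M ≃[lang n] M, g ≠ 1 → ∃ c, g c ≠ c := fun g hg => by
    by_contra! h
    exact hg (FirstOrder.Language.Equiv.ext fun x => h x)
  refine { exists_pair_ne := ?_, eq_bot_or_eq_top_of_normal := fun N hN => ?_ }
  · obtain ⟨a⟩ := nonempty_of_isFraisseLimit hM hn
    obtain ⟨x, hx, h, -⟩ := exists_insert_insert_of_rhoPair hM hδ
      (u := a) (u' := a) Set.finite_empty Set.finite_empty isPartialIso_empty isPartialIso_empty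
      (by simp) (by simp)
      (isPartialIso_id.mono (by rintro p (rfl | ⟨x, h, -⟩); exacts [rfl, h.elim]))
      (S := {a}) (Set.finite_singleton a) (fun _ => True)
    obtain ⟨g, hg⟩ := exists_equiv_of_isPartialIso hM (Set.finite_empty.insert _) h
    refine ⟨g, 1, fun h1 => hx ?_⟩
    have hxa := hg x a (Or.inl rfl)
    rw [h1] at hxa
    exact hxa
  · refine or_iff_not_imp_left.2 fun hN' => (Subgroup.eq_top_iff' N).2 fun f => ?_
    obtain ⟨g, hgN, hg1⟩ := (Subgroup.ne_bot_iff_exists_ne_one (H := N)).1 hN' |> fun ⟨g, hg⟩ =>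
      (⟨g, g.2, fun h => hg (Subtype.ext h)⟩ : ∃ g : M ≃[lang n] M, g ∈ N ∧ g ≠ 1)
    obtain ⟨h, hF⟩ := exists_isRich hM hδ (hmove _ hg1)
    have hFN : g⁻¹ * h⁻¹ * g * h ∈ N := by
      have := N.mul_mem (N.inv_mem hgN) (hN.conj_mem _ hgN h⁻¹)
      simpa [mul_assoc] using this
    by_cases hf : f = 1
    · exact hf ▸ N.one_mem
    · obtain ⟨α₁, α₂, rfl⟩ := hF.exists_eq_mul_conj hM hδ (hmove f hf)
      have hconj : ∀ α : M ≃[lang n] M,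
          α⁻¹ * (g⁻¹ * h⁻¹ * g * h) * α ∈ N := fun α => by
        simpa using hN.conj_mem _ hFN α⁻¹
      exact N.mul_mem (hconj α₂) (hconj α₁)

end Hypertournament

theorem propositionp {I : Type v} [Finite I] (n : I → ℕ) (hn : ∀ i, 2 ≤ n i)
    (δ : I) (hδ : n δ = 2) :
    (∃ (M : Type w) (_ : (Hypertournament.lang n).Structure M) (_ : Countable M),
      FirstOrder.Language.IsFraisseLimit (Hypertournament.finiteHypertournaments.{v, w} n) M) ∧
    ∀ (M : Type w) [(Hypertournament.lang n).Structure M] [Countable M],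
      FirstOrder.Language.IsFraisseLimit (Hypertournament.finiteHypertournaments.{v, w} n) M →
      Hypertournament.IsSWIR (Hypertournament.signIndep (M := M) hδ) ∧
      Hypertournament.IsFree (Hypertournament.signIndep (M := M) hδ) ∧
      IsSimpleGroup (FirstOrder.Language.Equiv (Hypertournament.lang n) M M) :=
  ⟨Hypertournament.exists_isFraisseLimit n hn, fun _ _ _ hM =>
    ⟨Hypertournament.isSWIR_signIndep hδ hM, Hypertournament.isFree_signIndep hδ,
      Hypertournament.isSimpleGroup_equiv hM hδ hn⟩⟩
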